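/- Let $(M,g)$ be a compact smooth Riemannian manifold without boundary, of dimension $m$ (not assumed connected), and let $\lambda,\mu\in\mathbb C$. Let $f=f_1+if_2:M\to\mathbb C$, with $f_1,f_2$ real-valued, be a smooth $(\lambda,\mu)$-eigenfunction, i.e. $$\Delta f=\lambda f,\qquad \kappa(f,f)=\mu f^2,$$ where in local coordinates $$\Delta\varphi=\sum_{i,j=1}^m\frac1{\sqrt{|g|}}\frac{\partial}{\partial x_j}\Big(g^{ij}\sqrt{|g|}\,\frac{\partial\varphi}{\partial x_i}\Big),\qquad \kappa(\varphi,\psi)=g(\nabla\varphi,\nabla\psi)=\sum_{i,j=1}^m g^{ij}\frac{\partial\varphi}{\partial x_i}\frac{\partial\psi}{\partial x_j}$$ are the Laplace-Beltrami operator and the complex bilinear conformality operator. Assume that $f$ is not a nonzero locally constant function (for connected $M$: $f$ is not a nonzero constant). Then, for integrals with respect to the Riemannian volume measure, all functions $f_1^af_2^b$ with integers $a,b\ge0$ are integrable, and: 1. if $a,b\ge 0$ are integers that are not both even, then $\displaystyle\int_M f_1^af_2^b=0$; 2. for all integers $a,b\ge0$, $$\int_M f_1^{2a}f_2^{2b}=\frac{\binom{a+b}{a}}{\binom{2a+2b}{2a}}\int_M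 f_1^{2a+2b}.$$ -/

import Mathlib

open MeasureTheory Bundle
open scoped Manifold ContDiff

noncomputable section

/-- A smooth Riemannian metric on the `m`-dimensional smooth manifold `M` (without boundary). -/
abbrev SmoothMetric (m : ℕ) (M : Type*) [TopologicalSpace M]
    [ChartedSpace (EuclideanSpace ℝ (Fin m)) M] [IsManifold (𝓡 m) ∞ M] : Type _ :=
  ContMDiffRiemannianMetric (𝓡 m) ∞ (EuclideanSpace ℝ (Fin m))
    (fun x : M ↦ TangentSpace (𝓡 m) x)

/-- The partial derivative `∂h/∂xᵢ` at `y` of a function on `ℝᵐ`. -/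
def coordDeriv {m : ℕ} {F : Type*} [NormedAddCommGroup F] [NormedSpace ℝ F]
    (i : Fin m) (h : EuclideanSpace ℝ (Fin m) → F) (y : EuclideanSpace ℝ (Fin m)) : F :=
  fderiv ℝ h y (EuclideanSpace.single i 1)

section LocalCoordinates

variable {m : ℕ} {M : Type*} [TopologicalSpace M]
  [ChartedSpace (EuclideanSpace ℝ (Fin m)) M] [IsManifold (𝓡 m) ∞ M]

/-- The matrix `g_{ij} = g(∂/∂xᵢ, ∂/∂xⱼ)` of the metric in the chart `e`, at the point of `M`
with coordinates `y ∈ e.target`. -/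
def gramMatrix (g : SmoothMetric m M) (e : OpenPartialHomeomorph M (EuclideanSpace ℝ (Fin m)))
    (y : EuclideanSpace ℝ (Fin m)) : Matrix (Fin m) (Fin m) ℝ :=
  Matrix.of fun i j ↦ g.inner (e.symm y)
    (mfderiv (𝓡 m) (𝓡 m) e.symm y (EuclideanSpace.single i (1 : ℝ)))
    (mfderiv (𝓡 m) (𝓡 m) e.symm y (EuclideanSpace.single j (1 : ℝ)))

/-- The Riemannian volume density `√|g|` in the chart `e`. -/
def volDensity (g : SmoothMetric m M) (e : OpenPartialHomeomorph M (EuclideanSpace ℝ (Fin m)))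
    (y : EuclideanSpace ℝ (Fin m)) : ℝ :=
  Real.sqrt (gramMatrix g e y).det

/-- The Laplace-Beltrami operator in the chart `e`, at the point with coordinates `y`:
`Δ u = ∑ᵢⱼ |g|^{-1/2} ∂ⱼ (g^{ij} |g|^{1/2} ∂ᵢ u)`. -/
def chartLaplacian (g : SmoothMetric m M)
    (e : OpenPartialHomeomorph M (EuclideanSpace ℝ (Fin m))) (u : M → ℂ)
    (y : EuclideanSpace ℝ (Fin m)) : ℂ :=
  ∑ i, ∑ j, ((1 / volDensity g e y : ℝ) : ℂ) *
    coordDeriv j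
      (fun z ↦ (((gramMatrix g e z)⁻¹ i j * volDensity g e z : ℝ) : ℂ) *
        coordDeriv i (u ∘ e.symm) z) y

/-- The complex bilinear conformality operator `κ(u, v) = g(∇u, ∇v)` in the chart `e`, at the
point with coordinates `y`: `κ(u, v) = ∑ᵢⱼ g^{ij} ∂ᵢ u ∂ⱼ v`. -/
def chartKappa (g : SmoothMetric m M)
    (e : OpenPartialHomeomorph M (EuclideanSpace ℝ (Fin m))) (u v : M → ℂ)
    (y : EuclideanSpace ℝ (Fin m)) : ℂ :=
  ∑ i, ∑ j, (((gramMatrix g e y)⁻¹ i j : ℝ) : ℂ) *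
    coordDeriv i (u ∘ e.symm) y * coordDeriv j (v ∘ e.symm) y

/-- `f` is a smooth `(lam, mu)`-eigenfunction: `Δ f = lam f` and `κ(f, f) = mu f²` on `M`.
The operators `Δ` and `κ` are given by the expressions above in all local coordinates (these do not
depend on the chart), and the equations are written in the charts of the atlas of `M`. -/
structure IsEigenfunction (g : SmoothMetric m M) (lam mu : ℂ) (f : M → ℂ) : Prop where
  smooth : ContMDiff (𝓡 m) 𝓘(ℝ, ℂ) ∞ f
  laplacian_eq : ∀ e ∈ atlas (EuclideanSpace ℝ (Fin m)) M, ∀ y ∈ e.target,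
    chartLaplacian g e f y = lam * f (e.symm y)
  kappa_eq : ∀ e ∈ atlas (EuclideanSpace ℝ (Fin m)) M, ∀ y ∈ e.target,
    chartKappa g e f f y = mu * f (e.symm y) ^ 2

/-- The Riemannian volume of the domain of the chart `e`, as a measure on `M` that is zero outside
this domain: the image under `e.symm` of `√|g| dx` on `e.target`. -/
def chartVolume [MeasurableSpace M] (g : SmoothMetric m M)
    (e : OpenPartialHomeomorph M (EuclideanSpace ℝ (Fin m))) : Measure M :=
  ((volume.restrict e.target).withDensity
    (fun y ↦ ENNReal.ofReal (volDensity g e y))).map e.symm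

/-- The Riemannian volume measure of `(M, g)`. The measures `chartVolume g e` agree on the overlaps
of charts; their supremum in the lattice of measures is the measure that restricts to
`chartVolume g e` on the domain of every chart `e` of the atlas (for `M` second countable). -/
def riemannianVolume [MeasurableSpace M] (g : SmoothMetric m M) : Measure M :=
  ⨆ e ∈ atlas (EuclideanSpace ℝ (Fin m)) M, chartVolume g e

end LocalCoordinates

end

/-! The product rule gives `Δ(f^n) = Λ_n f^n` with `Λ_n = nλ + n(n-1)μ`, so all powers of `f` are
Laplace eigenfunctions (`IsEigenfunction.chartLaplacian_pow`). On a compact manifold, Green's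
identity makes every eigenvalue real and nonpositive, and zero only for locally constant functions
(`laplacian_eigenvalue_nonpos`). If `f` is not locally constant, this gives `λ < 0`, and `Λ_n ≤ 0`
for large `n` forces `Re μ ≤ 0`. Hence `Λ_j - Λ_k = (j - k)(λ + (j + k - 1)μ)` is nonzero for `j ≠
k`, and `∫ f^j conj(f)^k = 0` by self-adjointness of `Δ`
(`IsEigenfunction.integral_pow_mul_conj_pow`).

So the distribution of `f` in the plane has the moments of a rotation invariant measure: the
infinitesimal rotation of any polynomial in `f` and `conj f` integrates to zero. Applied to `f₁^a
f₂^b` this is the recursion `a I(a-1, b+1) = b I(a+1, b-1)` for `I(a, b) = ∫ f₁^a f₂^b`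
(`integral_rotation_re_im`). It kills the moments with an odd exponent and reduces the others to
`I(2a+2b, 0)`.

Much of the file supplies the analysis: chart independence of `κ` and of the volume, and Green's
first identity. -/

noncomputable section

/-! ### Jacobians of coordinate changes -/

section Transition

variable {m : ℕ} {M : Type*} [TopologicalSpace M]

/-- The Jacobian matrix at `y` of the change of coordinates from `e` to `e'`. -/
def transitionJacobian (e e' : OpenPartialHomeomorph M (EuclideanSpace ℝ (Fin m)))
    (y : EuclideanSpace ℝ (Fin m)) : Matrix (Fin m) (Fin m) ℝ :=
  Matrix.of fun k j ↦ (fderiv ℝ (e' ∘ e.symm) y (EuclideanSpace.single j 1)) k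

lemma det_transitionJacobian (e e' : OpenPartialHomeomorph M (EuclideanSpace ℝ (Fin m)))
    (y : EuclideanSpace ℝ (Fin m)) :
    (transitionJacobian e e' y).det = (fderiv ℝ (e' ∘ e.symm) y).det := by
  rw [ContinuousLinearMap.det, ← LinearMap.det_toMatrix (EuclideanSpace.basisFun (Fin m) ℝ).toBasis]
  congr 1

end Transition

/-! ### The metric, its density and `κ` in charts: smoothness and transformation laws -/

section LocalGeometry

variable {m : ℕ} {M : Type*} [TopologicalSpace M]
  [ChartedSpace (EuclideanSpace ℝ (Fin m)) M] [IsManifold (𝓡 m) ∞ M]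

lemma contMDiffOn_symm_of_atlas {e : OpenPartialHomeomorph M (EuclideanSpace ℝ (Fin m))}
    (he : e ∈ atlas (EuclideanSpace ℝ (Fin m)) M) :
    ContMDiffOn (𝓡 m) (𝓡 m) ∞ e.symm e.target :=
  contMDiffOn_symm_of_mem_maximalAtlas (IsManifold.subset_maximalAtlas he)

lemma contMDiffOn_of_atlas {e : OpenPartialHomeomorph M (EuclideanSpace ℝ (Fin m))}
    (he : e ∈ atlas (EuclideanSpace ℝ (Fin m)) M) :
    ContMDiffOn (𝓡 m) (𝓡 m) ∞ e e.source :=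
  contMDiffOn_of_mem_maximalAtlas (IsManifold.subset_maximalAtlas he)

lemma mdifferentiable_of_atlas {e : OpenPartialHomeomorph M (EuclideanSpace ℝ (Fin m))}
    (he : e ∈ atlas (EuclideanSpace ℝ (Fin m)) M) : e.MDifferentiable (𝓡 m) (𝓡 m) :=
  ⟨(contMDiffOn_of_atlas he).mdifferentiableOn (by simp),
    (contMDiffOn_symm_of_atlas he).mdifferentiableOn (by simp)⟩

/-- A smooth function read in a chart is smooth on the target of the chart. -/
lemma contDiffOn_comp_symm {F : Type*} [NormedAddCommGroup F] [NormedSpace ℝ F]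
    {e : OpenPartialHomeomorph M (EuclideanSpace ℝ (Fin m))}
    (he : e ∈ atlas (EuclideanSpace ℝ (Fin m)) M) {u : M → F}
    (hu : ContMDiff (𝓡 m) 𝓘(ℝ, F) ∞ u) : ContDiffOn ℝ ∞ (u ∘ e.symm) e.target :=
  contMDiffOn_iff_contDiffOn.1 (hu.comp_contMDiffOn (contMDiffOn_symm_of_atlas he))

lemma contDiffOn_transition {e e' : OpenPartialHomeomorph M (EuclideanSpace ℝ (Fin m))}
    (he : e ∈ atlas (EuclideanSpace ℝ (Fin m)) M)
    (he' : e' ∈ atlas (EuclideanSpace ℝ (Fin m)) M) :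
    ContDiffOn ℝ ∞ (e' ∘ e.symm) (e.target ∩ e.symm ⁻¹' e'.source) :=
  contMDiffOn_iff_contDiffOn.1 ((contMDiffOn_of_atlas he').comp
    ((contMDiffOn_symm_of_atlas he).mono Set.inter_subset_left) Set.inter_subset_right)

/-- The metric at a point, read as a bilinear form on the model space. -/
def metricAt (g : SmoothMetric m M) (x : M) :
    EuclideanSpace ℝ (Fin m) →L[ℝ] EuclideanSpace ℝ (Fin m) →L[ℝ] ℝ := g.inner x

/-- The derivative of the inverse of a chart, as an endomorphism of the model space. -/
def chartFrame (e : OpenPartialHomeomorph M (EuclideanSpace ℝ (Fin m)))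
    (y : EuclideanSpace ℝ (Fin m)) :
    EuclideanSpace ℝ (Fin m) →L[ℝ] EuclideanSpace ℝ (Fin m) :=
  mfderiv (𝓡 m) (𝓡 m) e.symm y

lemma gramMatrix_apply (g : SmoothMetric m M)
    (e : OpenPartialHomeomorph M (EuclideanSpace ℝ (Fin m))) (y : EuclideanSpace ℝ (Fin m))
    (i j : Fin m) :
    gramMatrix g e y i j = metricAt g (e.symm y) (chartFrame e y (EuclideanSpace.single i 1))
      (chartFrame e y (EuclideanSpace.single j 1)) := rfl

lemma chartFrame_injective {e : OpenPartialHomeomorph M (EuclideanSpace ℝ (Fin m))}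
    (he : e ∈ atlas (EuclideanSpace ℝ (Fin m)) M) {y : EuclideanSpace ℝ (Fin m)}
    (hy : y ∈ e.target) : Function.Injective (chartFrame e y) :=
  (mdifferentiable_of_atlas he).symm.mfderiv_injective hy

lemma gramMatrix_dotProduct (g : SmoothMetric m M)
    (e : OpenPartialHomeomorph M (EuclideanSpace ℝ (Fin m))) (y : EuclideanSpace ℝ (Fin m))
    (v w : Fin m → ℝ) :
    v ⬝ᵥ (gramMatrix g e y).mulVec w = metricAt g (e.symm y)
      (chartFrame e y (WithLp.toLp 2 v)) (chartFrame e y (WithLp.toLp 2 w)) := by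
  have h : ∀ v : Fin m → ℝ, WithLp.toLp 2 v = ∑ i, v i • EuclideanSpace.single i (1 : ℝ) := by
    intro v
    ext i
    simp [Finset.sum_apply, Pi.single_apply]
  rw [h v, h w]
  simp only [map_sum, map_smul, _root_.sum_apply, _root_.smul_apply,
    dotProduct, Matrix.mulVec, gramMatrix_apply, smul_eq_mul, Finset.mul_sum]
  rw [Finset.sum_comm]
  refine Finset.sum_congr rfl fun i _ ↦ Finset.sum_congr rfl fun j _ ↦ by ring

lemma gramMatrix_posDef (g : SmoothMetric m M)
    {e : OpenPartialHomeomorph M (EuclideanSpace ℝ (Fin m))}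
    (he : e ∈ atlas (EuclideanSpace ℝ (Fin m)) M) {y : EuclideanSpace ℝ (Fin m)}
    (hy : y ∈ e.target) : (gramMatrix g e y).PosDef := by
  refine Matrix.PosDef.of_dotProduct_mulVec_pos ?_ ?_
  · ext i j
    simp only [Matrix.conjTranspose_apply, star_trivial]
    exact g.symm _ _ _
  · intro v hv
    rw [star_trivial, gramMatrix_dotProduct]
    refine g.pos _ _ fun h0 ↦ hv ?_
    have := chartFrame_injective he hy (h0.trans (map_zero (chartFrame e y)).symm)
    simpa using this

lemma contDiffOn_gramMatrix (g : SmoothMetric m M)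
    {e : OpenPartialHomeomorph M (EuclideanSpace ℝ (Fin m))}
    (he : e ∈ atlas (EuclideanSpace ℝ (Fin m)) M) (i j : Fin m) :
    ContDiffOn ℝ ∞ (fun y ↦ gramMatrix g e y i j) e.target := by
  rw [← contMDiffOn_iff_contDiffOn]
  -- The coordinate vector fields are images of constant fields under the tangent map of `e.symm`,
  -- hence smooth along `e.symm`; the smooth metric is then evaluated on two of them.
  have hV : ∀ i : Fin m, ContMDiffOn (𝓡 m) ((𝓡 m).prod (𝓡 m)) ∞
      (fun y ↦ (TotalSpace.mk' (EuclideanSpace ℝ (Fin m)) (E := fun x : M ↦ TangentSpace (𝓡 m) x)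
        (e.symm y) (mfderiv (𝓡 m) (𝓡 m) e.symm y (EuclideanSpace.single i (1 : ℝ)))))
        e.target := by
    intro i
    have h1 : ContMDiff (𝓡 m) ((𝓡 m).prod (𝓡 m)) ∞
        (fun y : EuclideanSpace ℝ (Fin m) ↦ (TotalSpace.mk' (EuclideanSpace ℝ (Fin m))
          (E := fun y : EuclideanSpace ℝ (Fin m) ↦ TangentSpace (𝓡 m) y)
          y (EuclideanSpace.single i (1 : ℝ)))) := fun y ↦
      contMDiffAt_vectorSpace_iff_contDiffAt.2 contDiffAt_const
    have h2 := ((contMDiffOn_symm_of_atlas he).contMDiffOn_tangentMapWithin (m := ∞) (by simp)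
      e.open_target.uniqueMDiffOn).comp h1.contMDiffOn (s := e.target) (fun y hy ↦ hy)
    refine h2.congr fun y hy ↦ ?_
    simp only [Function.comp_apply, tangentMapWithin, TotalSpace.mk']
    rw [mfderivWithin_of_isOpen e.open_target hy]
  intro y hy
  have hg := (g.contMDiff.comp_contMDiffOn (contMDiffOn_symm_of_atlas he)) y hy
  have : ContMDiffWithinAt (𝓡 m) ((𝓡 m).prod 𝓘(ℝ)) ∞
      (fun y ↦ TotalSpace.mk' ℝ (E := Bundle.Trivial M ℝ) (e.symm y) (g.inner (e.symm y)
        (mfderiv (𝓡 m) (𝓡 m) e.symm y (EuclideanSpace.single i (1 : ℝ)))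
        (mfderiv (𝓡 m) (𝓡 m) e.symm y (EuclideanSpace.single j (1 : ℝ))))) e.target y := by
    apply ContMDiffWithinAt.clm_bundle_apply₂ (F₁ := EuclideanSpace ℝ (Fin m))
      (F₂ := EuclideanSpace ℝ (Fin m))
    · exact hg
    · exact hV i y hy
    · exact hV j y hy
  simp only [contMDiffWithinAt_totalSpace] at this
  exact this.2

/-- Chain rule for `e.symm = e'.symm ∘ (e' ∘ e.symm)`, which holds only near `y`. -/
lemma chartFrame_transition {e e' : OpenPartialHomeomorph M (EuclideanSpace ℝ (Fin m))}
    (he : e ∈ atlas (EuclideanSpace ℝ (Fin m)) M)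
    (he' : e' ∈ atlas (EuclideanSpace ℝ (Fin m)) M) {y : EuclideanSpace ℝ (Fin m)}
    (hy : y ∈ e.target) (hy' : e.symm y ∈ e'.source) :
    chartFrame e y = (chartFrame e' ((e' ∘ e.symm) y)).comp (fderiv ℝ (e' ∘ e.symm) y) := by
  have hU : IsOpen (e.target ∩ e.symm ⁻¹' e'.source) :=
    e.isOpen_inter_preimage_symm e'.open_source
  have hd : DifferentiableAt ℝ (e' ∘ e.symm) y :=
    ((contDiffOn_transition he he').contDiffAt (hU.mem_nhds ⟨hy, hy'⟩)).differentiableAt (by simp)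
  have h1 := ((mdifferentiable_of_atlas he').mdifferentiableAt_symm
    (e'.map_source hy')).hasMFDerivAt.comp y hd.mdifferentiableAt.hasMFDerivAt
  have h2 : HasMFDerivAt (𝓡 m) (𝓡 m) e.symm y _ := h1.congr_of_eventuallyEq (by
    filter_upwards [hU.mem_nhds ⟨hy, hy'⟩] with z hz
    exact (e'.left_inv hz.2).symm)
  have h3 := h2.mfderiv
  rw [mfderiv_eq_fderiv] at h3
  exact h3

lemma gramMatrix_transition (g : SmoothMetric m M)
    {e e' : OpenPartialHomeomorph M (EuclideanSpace ℝ (Fin m))}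
    (he : e ∈ atlas (EuclideanSpace ℝ (Fin m)) M)
    (he' : e' ∈ atlas (EuclideanSpace ℝ (Fin m)) M) {y : EuclideanSpace ℝ (Fin m)}
    (hy : y ∈ e.target) (hy' : e.symm y ∈ e'.source) :
    gramMatrix g e y = (transitionJacobian e e' y).transpose * gramMatrix g e' ((e' ∘ e.symm) y) *
      transitionJacobian e e' y := by
  ext i j
  have h := gramMatrix_dotProduct g e' ((e' ∘ e.symm) y)
    (fun k ↦ transitionJacobian e e' y k i) (fun k ↦ transitionJacobian e e' y k j)
  rw [show e'.symm ((e' ∘ e.symm) y) = e.symm y from e'.left_inv hy'] at h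
  rw [gramMatrix_apply, chartFrame_transition he he' hy hy']
  rw [Matrix.mul_assoc, Matrix.mul_apply]
  exact h.symm

lemma volDensity_transition (g : SmoothMetric m M)
    {e e' : OpenPartialHomeomorph M (EuclideanSpace ℝ (Fin m))}
    (he : e ∈ atlas (EuclideanSpace ℝ (Fin m)) M)
    (he' : e' ∈ atlas (EuclideanSpace ℝ (Fin m)) M) {y : EuclideanSpace ℝ (Fin m)}
    (hy : y ∈ e.target) (hy' : e.symm y ∈ e'.source) :
    volDensity g e y =
      |(fderiv ℝ (e' ∘ e.symm) y).det| * volDensity g e' ((e' ∘ e.symm) y) := by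
  rw [volDensity, gramMatrix_transition g he he' hy hy', Matrix.det_mul, Matrix.det_mul,
    Matrix.det_transpose, det_transitionJacobian,
    show ∀ a b : ℝ, a * b * a = a ^ 2 * b by intros; ring, Real.sqrt_mul (sq_nonneg _),
    Real.sqrt_sq_eq_abs, volDensity]

lemma volDensity_pos (g : SmoothMetric m M)
    {e : OpenPartialHomeomorph M (EuclideanSpace ℝ (Fin m))}
    (he : e ∈ atlas (EuclideanSpace ℝ (Fin m)) M) {y : EuclideanSpace ℝ (Fin m)}
    (hy : y ∈ e.target) : 0 < volDensity g e y :=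
  Real.sqrt_pos.2 (gramMatrix_posDef g he hy).det_pos

lemma contDiffOn_det_gramMatrix (g : SmoothMetric m M)
    {e : OpenPartialHomeomorph M (EuclideanSpace ℝ (Fin m))}
    (he : e ∈ atlas (EuclideanSpace ℝ (Fin m)) M) :
    ContDiffOn ℝ ∞ (fun y ↦ (gramMatrix g e y).det) e.target := by
  simp only [Matrix.det_apply]
  exact ContDiffOn.sum fun s _ ↦ (contDiffOn_prod fun i _ ↦
    contDiffOn_gramMatrix g he _ _).const_smul _

lemma contDiffOn_volDensity (g : SmoothMetric m M)
    {e : OpenPartialHomeomorph M (EuclideanSpace ℝ (Fin m))}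
    (he : e ∈ atlas (EuclideanSpace ℝ (Fin m)) M) :
    ContDiffOn ℝ ∞ (volDensity g e) e.target :=
  (contDiffOn_det_gramMatrix g he).sqrt fun _ hy ↦ (gramMatrix_posDef g he hy).det_pos.ne'

/-- By Cramer's rule the entries are polynomials in the `g_{ij}` divided by the nonvanishing
determinant. -/
lemma contDiffOn_inv_gramMatrix (g : SmoothMetric m M)
    {e : OpenPartialHomeomorph M (EuclideanSpace ℝ (Fin m))}
    (he : e ∈ atlas (EuclideanSpace ℝ (Fin m)) M) (i j : Fin m) :
    ContDiffOn ℝ ∞ (fun y ↦ (gramMatrix g e y)⁻¹ i j) e.target := by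
  have h : ∀ y, (gramMatrix g e y)⁻¹ i j =
      (gramMatrix g e y).det⁻¹ * (gramMatrix g e y).adjugate i j := by
    intro y
    rw [Matrix.inv_def, Ring.inverse_eq_inv', Matrix.smul_apply, smul_eq_mul]
  simp only [h]
  refine ((contDiffOn_det_gramMatrix g he).inv
    fun _ hy ↦ (gramMatrix_posDef g he hy).det_pos.ne').mul ?_
  simp only [Matrix.adjugate_apply, Matrix.det_apply]
  refine ContDiffOn.sum fun s _ ↦ (contDiffOn_prod fun k _ ↦ ?_).const_smul _
  simp only [Matrix.updateRow_apply]
  split_ifs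
  · exact contDiffOn_const
  · exact contDiffOn_gramMatrix g he _ _

lemma coordDeriv_transition {e e' : OpenPartialHomeomorph M (EuclideanSpace ℝ (Fin m))}
    (he : e ∈ atlas (EuclideanSpace ℝ (Fin m)) M)
    (he' : e' ∈ atlas (EuclideanSpace ℝ (Fin m)) M) {y : EuclideanSpace ℝ (Fin m)}
    (hy : y ∈ e.target) (hy' : e.symm y ∈ e'.source) {u : M → ℂ}
    (hu : ContMDiff (𝓡 m) 𝓘(ℝ, ℂ) ∞ u) (i : Fin m) :
    coordDeriv i (u ∘ e.symm) y = ∑ k, (transitionJacobian e e' y k i : ℂ) *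
      coordDeriv k (u ∘ e'.symm) ((e' ∘ e.symm) y) := by
  have hU : IsOpen (e.target ∩ e.symm ⁻¹' e'.source) :=
    e.isOpen_inter_preimage_symm e'.open_source
  have hd : DifferentiableAt ℝ (e' ∘ e.symm) y :=
    ((contDiffOn_transition he he').contDiffAt (hU.mem_nhds ⟨hy, hy'⟩)).differentiableAt (by simp)
  have hd' : DifferentiableAt ℝ (u ∘ e'.symm) ((e' ∘ e.symm) y) :=
    ((contDiffOn_comp_symm he' hu).contDiffAt
      (e'.open_target.mem_nhds (e'.map_source hy'))).differentiableAt (by simp)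
  have h1 : HasFDerivAt (u ∘ e.symm) _ y :=
    (hd'.hasFDerivAt.comp y hd.hasFDerivAt).congr_of_eventuallyEq (by
      filter_upwards [hU.mem_nhds ⟨hy, hy'⟩] with z hz
      simp [e'.left_inv hz.2])
  have h : ∀ v : EuclideanSpace ℝ (Fin m), v = ∑ k, v k • EuclideanSpace.single k (1 : ℝ) := by
    intro v
    ext i
    simp [Finset.sum_apply, Pi.single_apply]
  rw [coordDeriv, h1.fderiv, ContinuousLinearMap.comp_apply,
    h (fderiv ℝ (e' ∘ e.symm) y (EuclideanSpace.single i 1)), map_sum]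
  simp [coordDeriv, transitionJacobian]

/-- The conformality operator does not depend on the chart. -/
lemma chartKappa_transition (g : SmoothMetric m M)
    {e e' : OpenPartialHomeomorph M (EuclideanSpace ℝ (Fin m))}
    (he : e ∈ atlas (EuclideanSpace ℝ (Fin m)) M)
    (he' : e' ∈ atlas (EuclideanSpace ℝ (Fin m)) M) {y : EuclideanSpace ℝ (Fin m)}
    (hy : y ∈ e.target) (hy' : e.symm y ∈ e'.source) {u v : M → ℂ}
    (hu : ContMDiff (𝓡 m) 𝓘(ℝ, ℂ) ∞ u) (hv : ContMDiff (𝓡 m) 𝓘(ℝ, ℂ) ∞ v) :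
    chartKappa g e u v y = chartKappa g e' u v ((e' ∘ e.symm) y) := by
  have hG := gramMatrix_transition g he he' hy hy'
  set J := transitionJacobian e e' y
  set G := gramMatrix g e y
  set G' := gramMatrix g e' ((e' ∘ e.symm) y)
  have hGdet : G.det ≠ 0 := (gramMatrix_posDef g he hy).det_pos.ne'
  have hJdet : J.det ≠ 0 := by
    rw [hG, Matrix.det_mul] at hGdet
    exact right_ne_zero_of_mul hGdet
  -- The inverse metric transforms contravariantly; this is exactly the combination of `J` and `G⁻¹`
  -- that the chain rule produces from the two first derivatives.
  have hinv : J * G⁻¹ * J.transpose = G'⁻¹ := by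
    have hJT : IsUnit J.transpose.det := by
      rw [Matrix.det_transpose]; exact hJdet.isUnit
    rw [hG, Matrix.mul_inv_rev, Matrix.mul_inv_rev, ← Matrix.mul_assoc,
      Matrix.mul_nonsing_inv _ hJdet.isUnit, Matrix.one_mul, Matrix.mul_assoc,
      Matrix.nonsing_inv_mul _ hJT, Matrix.mul_one]
  have hentry : ∀ k l, ((G'⁻¹ k l : ℝ) : ℂ) =
      ∑ i, ∑ j, (J k i : ℂ) * ((G⁻¹ i j : ℝ) : ℂ) * (J l j : ℂ) := by
    intro k l
    rw [← hinv, Matrix.mul_apply]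
    simp only [Matrix.mul_apply, Matrix.transpose_apply, Complex.ofReal_sum, Complex.ofReal_mul,
      Finset.sum_mul]
    exact Finset.sum_comm
  unfold chartKappa
  simp only [coordDeriv_transition he he' hy hy' hu, coordDeriv_transition he he' hy hy' hv]
  change ∑ i, ∑ j, ((G⁻¹ i j : ℝ) : ℂ) * _ * _ = ∑ k, ∑ l, ((G'⁻¹ k l : ℝ) : ℂ) * _ * _
  simp only [hentry, Finset.mul_sum, Finset.sum_mul]
  symm
  calc _ = ∑ k, ∑ i, ∑ l, ∑ j, _ := Finset.sum_congr rfl fun _ _ ↦ Finset.sum_comm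
    _ = ∑ i, ∑ k, ∑ l, ∑ j, _ := Finset.sum_comm
    _ = ∑ i, ∑ k, ∑ j, ∑ l, _ :=
      Finset.sum_congr rfl fun _ _ ↦ Finset.sum_congr rfl fun _ _ ↦ Finset.sum_comm
    _ = ∑ i, ∑ j, ∑ k, ∑ l, _ := Finset.sum_congr rfl fun _ _ ↦ Finset.sum_comm
    _ = ∑ i, ∑ j, ∑ l, ∑ k, _ :=
      Finset.sum_congr rfl fun _ _ ↦ Finset.sum_congr rfl fun _ _ ↦ Finset.sum_comm
    _ = _ := by
      refine Finset.sum_congr rfl fun i _ ↦ Finset.sum_congr rfl fun j _ ↦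
        Finset.sum_congr rfl fun l _ ↦ Finset.sum_congr rfl fun k _ ↦ ?_
      ring

end LocalGeometry

/-! ### The Riemannian volume measure -/

section Volume

variable {m : ℕ} {M : Type*} [TopologicalSpace M]
  [ChartedSpace (EuclideanSpace ℝ (Fin m)) M] [IsManifold (𝓡 m) ∞ M]

lemma aemeasurable_volDensity (g : SmoothMetric m M)
    {e : OpenPartialHomeomorph M (EuclideanSpace ℝ (Fin m))}
    (he : e ∈ atlas (EuclideanSpace ℝ (Fin m)) M) :
    AEMeasurable (volDensity g e) (volume.restrict e.target) :=
  (contDiffOn_volDensity g he).continuousOn.aemeasurable e.open_target.measurableSet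

variable [MeasurableSpace M]

lemma chartVolume_le_riemannianVolume (g : SmoothMetric m M)
    {e : OpenPartialHomeomorph M (EuclideanSpace ℝ (Fin m))}
    (he : e ∈ atlas (EuclideanSpace ℝ (Fin m)) M) : chartVolume g e ≤ riemannianVolume g :=
  le_iSup₂ (f := fun e (_ : e ∈ atlas (EuclideanSpace ℝ (Fin m)) M) ↦ chartVolume g e) e he

variable [BorelSpace M]

/-- `e.symm` is controlled only on `e.target`, so the pushforward in `chartVolume` has to be handled
through almost everywhere measurability. -/
lemma aemeasurable_symm {X Y : Type*} [TopologicalSpace X] [TopologicalSpace Y]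
    [MeasurableSpace X] [MeasurableSpace Y] [BorelSpace X] [BorelSpace Y] (μ : Measure Y)
    (e : OpenPartialHomeomorph X Y) : AEMeasurable e.symm (μ.restrict e.target) :=
  e.continuousOn_symm.aemeasurable e.open_target.measurableSet

lemma measurableSet_target_inter_preimage_symm {X Y : Type*} [TopologicalSpace X]
    [TopologicalSpace Y] [MeasurableSpace X] [MeasurableSpace Y] [BorelSpace X] [BorelSpace Y]
    (e : OpenPartialHomeomorph X Y) {S : Set X} (hS : MeasurableSet S) :
    MeasurableSet (e.target ∩ e.symm ⁻¹' S) := by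
  have h : Measurable (e.target.domRestrict e.symm) :=
    (continuousOn_iff_continuous_domRestrict.1 e.continuousOn_symm).measurable
  have := e.open_target.measurableSet.subtype_image (h hS)
  rwa [show (fun x : e.target ↦ (x : Y)) '' (e.target.domRestrict e.symm ⁻¹' S) =
    e.target ∩ e.symm ⁻¹' S by ext y; simp [and_comm]] at this

lemma chartVolume_apply (g : SmoothMetric m M)
    (e : OpenPartialHomeomorph M (EuclideanSpace ℝ (Fin m))) {S : Set M} (hS : MeasurableSet S) :
    chartVolume g e S =
      ∫⁻ y in e.target ∩ e.symm ⁻¹' S, ENNReal.ofReal (volDensity g e y) := by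
  have hae := aemeasurable_symm volume e
  rw [chartVolume, Measure.map_apply_of_aemeasurable
    (hae.mono_ac (withDensity_absolutelyContinuous _ _)) hS,
    withDensity_apply₀ _ (hae.nullMeasurableSet_preimage hS),
    Measure.restrict_restrict₀ (hae.nullMeasurableSet_preimage hS), Set.inter_comm]

lemma chartVolume_compl_source (g : SmoothMetric m M)
    (e : OpenPartialHomeomorph M (EuclideanSpace ℝ (Fin m))) : chartVolume g e e.sourceᶜ = 0 := by
  rw [chartVolume_apply g e e.open_source.measurableSet.compl]
  have : e.target ∩ e.symm ⁻¹' e.sourceᶜ = ∅ := by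
    ext y
    simpa using fun hy ↦ e.map_target hy
  rw [this, Measure.restrict_empty, lintegral_zero_measure]

/-- The Riemannian volumes of two charts agree on the overlap of the charts. -/
lemma chartVolume_eq_of_subset (g : SmoothMetric m M)
    {e e' : OpenPartialHomeomorph M (EuclideanSpace ℝ (Fin m))}
    (he : e ∈ atlas (EuclideanSpace ℝ (Fin m)) M)
    (he' : e' ∈ atlas (EuclideanSpace ℝ (Fin m)) M) {S : Set M} (hS : MeasurableSet S)
    (hSe : S ⊆ e.source) (hSe' : S ⊆ e'.source) : chartVolume g e S = chartVolume g e' S := by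
  rw [chartVolume_apply g e hS, chartVolume_apply g e' hS]
  -- The two coordinate images of `S` correspond under the transition map, so the change of
  -- variables formula applies; its Jacobian is the factor in `volDensity_transition`.
  have himage : e'.target ∩ e'.symm ⁻¹' S = (e' ∘ e.symm) '' (e.target ∩ e.symm ⁻¹' S) := by
    ext y
    constructor
    · rintro ⟨hy, hyS⟩
      exact ⟨e (e'.symm y), ⟨e.map_source (hSe hyS), by simpa [e.left_inv (hSe hyS)] using hyS⟩,
        by simp [e.left_inv (hSe hyS), e'.right_inv hy]⟩
    · rintro ⟨z, ⟨hz, hzS⟩, rfl⟩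
      exact ⟨e'.map_source (hSe' hzS), by simpa [e'.left_inv (hSe' hzS)] using hzS⟩
  have hU : IsOpen (e.target ∩ e.symm ⁻¹' e'.source) :=
    e.isOpen_inter_preimage_symm e'.open_source
  have hinj : Set.InjOn (e' ∘ e.symm) (e.target ∩ e.symm ⁻¹' S) :=
    fun y hy z hz h ↦ e.symm.injOn hy.1 hz.1 (e'.injOn (hSe' hy.2) (hSe' hz.2) h)
  have hmeas := measurableSet_target_inter_preimage_symm e hS
  rw [himage, lintegral_image_eq_lintegral_abs_det_fderiv_mul volume hmeas
    (f' := fun y ↦ fderiv ℝ (e' ∘ e.symm) y) (fun y hy ↦ ?_) hinj]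
  · refine setLIntegral_congr_fun hmeas fun y hy ↦ ?_
    rw [volDensity_transition g he he' hy.1 (hSe' hy.2), ENNReal.ofReal_mul (abs_nonneg _)]
  · exact (((contDiffOn_transition he he').contDiffAt
      (hU.mem_nhds ⟨hy.1, hSe' hy.2⟩)).differentiableAt (by simp)).hasFDerivAt.hasFDerivWithinAt

/-- On the domain of a chart, the Riemannian volume is the volume of the chart. -/
lemma riemannianVolume_restrict_source (g : SmoothMetric m M)
    {e : OpenPartialHomeomorph M (EuclideanSpace ℝ (Fin m))}
    (he : e ∈ atlas (EuclideanSpace ℝ (Fin m)) M) :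
    (riemannianVolume g).restrict e.source = chartVolume g e := by
  have hs : MeasurableSet e.source := e.open_source.measurableSet
  have hself : (chartVolume g e).restrict e.source = chartVolume g e :=
    Measure.restrict_eq_self_of_ae_mem (chartVolume_compl_source g e)
  apply le_antisymm
  · have hle : riemannianVolume g ≤
        chartVolume g e + (riemannianVolume g).restrict e.sourceᶜ := by
      refine iSup₂_le fun e' he' ↦ Measure.le_iff.2 fun S hS ↦ ?_
      rw [← measure_inter_add_sdiff S hs, Measure.add_apply, Measure.restrict_apply hS]
      refine add_le_add ?_ (chartVolume_le_riemannianVolume g he' _)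
      have h1 : chartVolume g e' (S ∩ e.source) = chartVolume g e' (S ∩ e.source ∩ e'.source) := by
        rw [Set.inter_comm _ e'.source, Measure.measure_inter_eq_of_ae
          (show ∀ᵐ x ∂(chartVolume g e'), x ∈ e'.source from chartVolume_compl_source g e')]
      rw [h1, chartVolume_eq_of_subset g he' he ((hS.inter hs).inter e'.open_source.measurableSet)
        Set.inter_subset_right (Set.inter_subset_left.trans Set.inter_subset_right)]
      exact measure_mono (Set.inter_subset_left.trans Set.inter_subset_left)
    refine (Measure.restrict_mono le_rfl hle).trans ?_
    rw [Measure.restrict_add, hself, Measure.restrict_restrict hs, Set.inter_compl_self,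
      Measure.restrict_empty, add_zero]
  · rw [← hself]
    exact Measure.restrict_mono le_rfl (chartVolume_le_riemannianVolume g he)

/-- The density is continuous, hence integrable on a compact neighbourhood inside the chart. This
makes continuous functions integrable on compact `M`. -/
instance (g : SmoothMetric m M) : IsLocallyFiniteMeasure (riemannianVolume g) := by
  refine ⟨fun x ↦ ?_⟩
  set e := chartAt (EuclideanSpace ℝ (Fin m)) x
  have he : e ∈ atlas (EuclideanSpace ℝ (Fin m)) M := chart_mem_atlas _ x
  obtain ⟨K, hK, hxK, hKe⟩ := exists_compact_subset e.open_target (mem_chart_target _ x)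
  have hopen := e.isOpen_inter_preimage isOpen_interior (s := interior K)
  refine ⟨_, hopen.mem_nhds ⟨mem_chart_source _ x, hxK⟩, ?_⟩
  rw [← Measure.restrict_eq_self _ Set.inter_subset_left, riemannianVolume_restrict_source g he,
    chartVolume_apply g e hopen.measurableSet]
  have hint : IntegrableOn (volDensity g e) K :=
    ((contDiffOn_volDensity g he).continuousOn.mono hKe).integrableOn_compact hK
  refine (lintegral_mono_set ?_).trans_lt hint.lintegral_lt_top
  rintro y ⟨hy, hy'⟩
  simpa [e.right_inv hy] using interior_subset hy'.2

/-- Needed for `∫ ‖v‖² > 0` when `v ≠ 0`, and to pass from almost everywhere zero to zero for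
continuous functions. -/
instance (g : SmoothMetric m M) : (riemannianVolume g).IsOpenPosMeasure := by
  refine ⟨fun U hU ⟨x, hx⟩ h0 ↦ ?_⟩
  set e := chartAt (EuclideanSpace ℝ (Fin m)) x
  have he : e ∈ atlas (EuclideanSpace ℝ (Fin m)) M := chart_mem_atlas _ x
  have hae := aemeasurable_symm volume e
  have h1 : chartVolume g e U = 0 :=
    le_antisymm ((chartVolume_le_riemannianVolume g he U).trans h0.le) zero_le
  rw [chartVolume, Measure.map_apply_of_aemeasurable
    (hae.mono_ac (withDensity_absolutelyContinuous _ _)) hU.measurableSet] at h1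
  -- Since the density is positive on `e.target`, a null set for the weighted measure is Lebesgue
  -- null.
  have h2 := withDensity_absolutelyContinuous' (aemeasurable_volDensity g he).ennreal_ofReal (by
    filter_upwards [ae_restrict_mem e.open_target.measurableSet] with y hy
    simpa using volDensity_pos g he hy) h1
  rw [Measure.restrict_apply₀ (hae.nullMeasurableSet_preimage hU.measurableSet),
    Set.inter_comm] at h2
  exact (e.isOpen_inter_preimage_symm hU).measure_ne_zero volume
    ⟨e x, mem_chart_target _ x, by simpa [e, e.left_inv (mem_chart_source _ x)] using hx⟩ h2

/-- The integral of a continuous function supported in the domain of a chart, in coordinates. -/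
lemma integral_riemannianVolume_eq (g : SmoothMetric m M)
    {e : OpenPartialHomeomorph M (EuclideanSpace ℝ (Fin m))}
    (he : e ∈ atlas (EuclideanSpace ℝ (Fin m)) M) {h : M → ℂ} (hc : Continuous h)
    (hsupp : ∀ x ∉ e.source, h x = 0) :
    ∫ x, h x ∂(riemannianVolume g) =
      ∫ y in e.target, (volDensity g e y : ℂ) * h (e.symm y) := by
  have hae := aemeasurable_symm volume e
  rw [← setIntegral_eq_integral_of_forall_compl_eq_zero hsupp,
    riemannianVolume_restrict_source g he, chartVolume, integral_map
    (hae.mono_ac (withDensity_absolutelyContinuous _ _)) hc.aestronglyMeasurable,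
    integral_withDensity_eq_integral_toReal_smul₀ (aemeasurable_volDensity g he).ennreal_ofReal
      (by simp)]
  refine setIntegral_congr_fun e.open_target.measurableSet fun y hy ↦ ?_
  rw [ENNReal.toReal_ofReal (volDensity_pos g he hy).le, Complex.real_smul]

end Volume

/-! ### Green's first identity -/

section Green

variable {m : ℕ} {M : Type*} [TopologicalSpace M]
  [ChartedSpace (EuclideanSpace ℝ (Fin m)) M] [IsManifold (𝓡 m) ∞ M]

lemma ContDiffOn.coordDeriv {h : EuclideanSpace ℝ (Fin m) → ℂ}
    {U : Set (EuclideanSpace ℝ (Fin m))} (hh : ContDiffOn ℝ ∞ h U) (hU : IsOpen U) (i : Fin m) :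
    ContDiffOn ℝ ∞ (coordDeriv i h) U :=
  (hh.fderiv_of_isOpen hU (m := ∞) (by simp)).clm_apply contDiffOn_const

lemma Filter.EventuallyEq.coordDeriv_eq {h k : EuclideanSpace ℝ (Fin m) → ℂ}
    {y : EuclideanSpace ℝ (Fin m)} (hk : h =ᶠ[nhds y] k) (i : Fin m) :
    coordDeriv i h y = coordDeriv i k y := by
  rw [coordDeriv, coordDeriv, hk.fderiv_eq]

/-- The flux `g^{ij} √|g| ∂ᵢ u` of the gradient of `u` in a chart. -/
def chartFlux (g : SmoothMetric m M) (e : OpenPartialHomeomorph M (EuclideanSpace ℝ (Fin m)))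
    (u : M → ℂ) (i j : Fin m) (z : EuclideanSpace ℝ (Fin m)) : ℂ :=
  (((gramMatrix g e z)⁻¹ i j * volDensity g e z : ℝ) : ℂ) * coordDeriv i (u ∘ e.symm) z

lemma contDiffOn_chartFlux (g : SmoothMetric m M)
    {e : OpenPartialHomeomorph M (EuclideanSpace ℝ (Fin m))}
    (he : e ∈ atlas (EuclideanSpace ℝ (Fin m)) M) {u : M → ℂ}
    (hu : ContMDiff (𝓡 m) 𝓘(ℝ, ℂ) ∞ u) (i j : Fin m) :
    ContDiffOn ℝ ∞ (chartFlux g e u i j) e.target :=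
  (Complex.ofRealCLM.contDiff.comp_contDiffOn ((contDiffOn_inv_gramMatrix g he i j).mul
    (contDiffOn_volDensity g he))).mul ((contDiffOn_comp_symm he hu).coordDeriv e.open_target i)

lemma volDensity_mul_chartLaplacian (g : SmoothMetric m M)
    {e : OpenPartialHomeomorph M (EuclideanSpace ℝ (Fin m))}
    (he : e ∈ atlas (EuclideanSpace ℝ (Fin m)) M) (u : M → ℂ) {y : EuclideanSpace ℝ (Fin m)}
    (hy : y ∈ e.target) :
    (volDensity g e y : ℂ) * chartLaplacian g e u y =
      ∑ i, ∑ j, coordDeriv j (chartFlux g e u i j) y := by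
  have h : (volDensity g e y : ℂ) ≠ 0 := Complex.ofReal_ne_zero.2 (volDensity_pos g he hy).ne'
  simp only [chartLaplacian, Finset.mul_sum]
  refine Finset.sum_congr rfl fun i _ ↦ Finset.sum_congr rfl fun j _ ↦ ?_
  rw [Complex.ofReal_div, Complex.ofReal_one, ← mul_assoc, mul_one_div_cancel h, one_mul]
  rfl

lemma volDensity_mul_chartKappa (g : SmoothMetric m M)
    (e : OpenPartialHomeomorph M (EuclideanSpace ℝ (Fin m))) (u v : M → ℂ)
    (y : EuclideanSpace ℝ (Fin m)) :
    (volDensity g e y : ℂ) * chartKappa g e u v y =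
      ∑ i, ∑ j, coordDeriv j (v ∘ e.symm) y * chartFlux g e u i j y := by
  simp only [chartKappa, Finset.mul_sum, chartFlux, Complex.ofReal_mul]
  exact Finset.sum_congr rfl fun i _ ↦ Finset.sum_congr rfl fun j _ ↦ by ring

/-- Allows a factor `Q` with no regularity outside `U`, such as a flux, which is meaningful only on
the chart target. -/
lemma integrable_mul_of_tsupport_subset {X : Type*} [TopologicalSpace X] [MeasurableSpace X]
    [OpensMeasurableSpace X] {μ : Measure X} [IsFiniteMeasureOnCompacts μ]
    {P Q : X → ℂ} {U : Set X} (hP : Continuous P) (hc : HasCompactSupport P)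
    (hPU : tsupport P ⊆ U) (hQ : ContinuousOn Q U) : Integrable (fun x ↦ P x * Q x) μ := by
  have hsub : Function.support (fun x ↦ P x * Q x) ⊆ tsupport P := fun x hx ↦
    subset_tsupport P fun h ↦ hx (by simp [h])
  rw [← integrableOn_iff_integrable_of_support_subset hsub]
  exact (hP.continuousOn.mul (hQ.mono hPU)).integrableOn_compact' hc
    (isClosed_tsupport P).measurableSet

/-- Green's first identity in a chart. -/
lemma integral_mul_chartLaplacian [T2Space M] [CompactSpace M] (g : SmoothMetric m M)
    {e : OpenPartialHomeomorph M (EuclideanSpace ℝ (Fin m))}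
    (he : e ∈ atlas (EuclideanSpace ℝ (Fin m)) M) {v w : M → ℂ}
    (hv : ContMDiff (𝓡 m) 𝓘(ℝ, ℂ) ∞ v) (hw : ContMDiff (𝓡 m) 𝓘(ℝ, ℂ) ∞ w)
    (hwe : tsupport w ⊆ e.source) :
    ∫ y in e.target, (volDensity g e y : ℂ) * (w (e.symm y) * chartLaplacian g e v y) =
      -∫ y in e.target, (volDensity g e y : ℂ) * chartKappa g e v w y := by
  -- Extension by zero of `w` in coordinates. As `w` has compact support inside the chart, `W` is
  -- smooth with compact support on all of `ℝᵐ`, so integration by parts has no boundary term.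
  set W : EuclideanSpace ℝ (Fin m) → ℂ := e.target.indicator (w ∘ e.symm) with hWdef
  have hK : IsCompact (e '' tsupport w) :=
    (isClosed_tsupport w).isCompact.image_of_continuousOn (e.continuousOn.mono hwe)
  have hKe : e '' tsupport w ⊆ e.target := by
    rintro _ ⟨x, hx, rfl⟩
    exact e.map_source (hwe hx)
  have hWK : ∀ y ∉ e '' tsupport w, W y = 0 := by
    intro y hy
    by_cases hyt : y ∈ e.target
    · rw [hWdef, Set.indicator_of_mem hyt]
      exact image_eq_zero_of_notMem_tsupport (f := w) fun h ↦ hy ⟨_, h, e.right_inv hyt⟩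
    · exact Set.indicator_of_notMem hyt _
  have hWc : HasCompactSupport W := HasCompactSupport.intro hK hWK
  have hWt : tsupport W ⊆ e.target :=
    (closure_minimal (Function.support_subset_iff'.2 hWK) hK.isClosed).trans hKe
  have hWe : ∀ y ∈ e.target, W =ᶠ[nhds y] w ∘ e.symm := fun y hy ↦ by
    filter_upwards [e.open_target.mem_nhds hy] with z hz
    exact Set.indicator_of_mem hz _
  have hWs : ContDiff ℝ ∞ W := by
    refine contDiff_iff_contDiffAt.2 fun y ↦ ?_
    by_cases hy : y ∈ e.target
    · exact ((contDiffOn_comp_symm he hw).contDiffAt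
        (e.open_target.mem_nhds hy)).congr_of_eventuallyEq (hWe y hy)
    · have : W =ᶠ[nhds y] fun _ ↦ 0 := by
        filter_upwards [hK.isClosed.isOpen_compl.mem_nhds fun h ↦ hy (hKe h)] with z hz
        exact hWK z hz
      exact contDiffAt_const.congr_of_eventuallyEq this
  have hA := contDiffOn_chartFlux g he hv
  have hdW : ∀ j, Continuous (coordDeriv j W) := fun j ↦ continuousOn_univ.1
    ((contDiffOn_univ.2 hWs).coordDeriv isOpen_univ j).continuousOn
  have hsuppdW : ∀ j, Function.support (coordDeriv j W) ⊆ tsupport W := fun j y hy ↦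
    support_fderiv_subset ℝ fun h ↦ hy (by simp [coordDeriv, h])
  have hdWc : ∀ j, HasCompactSupport (coordDeriv j W) := fun j ↦ hWc.mono' (hsuppdW j)
  have hdWt : ∀ j, tsupport (coordDeriv j W) ⊆ e.target := fun j ↦
    (closure_minimal (hsuppdW j) (isClosed_tsupport W)).trans hWt
  have hi1 : ∀ i j, Integrable (fun y ↦ coordDeriv j W y * chartFlux g e v i j y) := fun i j ↦
    integrable_mul_of_tsupport_subset (hdW j) (hdWc j) (hdWt j) (hA i j).continuousOn
  have hi2 : ∀ i j, Integrable (fun y ↦ W y * coordDeriv j (chartFlux g e v i j) y) := fun i j ↦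
    integrable_mul_of_tsupport_subset hWs.continuous hWc hWt
      ((hA i j).coordDeriv e.open_target j).continuousOn
  have hi3 : ∀ i j, Integrable (fun y ↦ W y * chartFlux g e v i j y) := fun i j ↦
    integrable_mul_of_tsupport_subset hWs.continuous hWc hWt (hA i j).continuousOn
  have hparts : ∀ i j, ∫ y, W y * coordDeriv j (chartFlux g e v i j) y =
      -∫ y, coordDeriv j W y * chartFlux g e v i j y := fun i j ↦
    integral_mul_fderiv_eq_neg_fderiv_mul_of_integrable (hi1 i j) (hi2 i j) (hi3 i j)
      (fun y _ ↦ hWs.differentiable (by simp) y)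
      (fun y hy ↦ ((hA i j).contDiffAt (e.open_target.mem_nhds (hWt hy))).differentiableAt
        (by simp))
  have hL : ∫ y in e.target, (volDensity g e y : ℂ) * (w (e.symm y) * chartLaplacian g e v y) =
      ∫ y, ∑ i, ∑ j, W y * coordDeriv j (chartFlux g e v i j) y := by
    symm
    rw [← setIntegral_eq_integral_of_forall_compl_eq_zero (s := e.target)]
    · refine setIntegral_congr_fun e.open_target.measurableSet fun y hy ↦ ?_
      simp only [← Finset.mul_sum, ← volDensity_mul_chartLaplacian g he v hy]
      rw [hWdef, Set.indicator_of_mem hy, Function.comp_apply]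
      ring
    · intro y hy
      simp [hWdef, Set.indicator_of_notMem hy]
  have hR : ∫ y in e.target, (volDensity g e y : ℂ) * chartKappa g e v w y =
      ∫ y, ∑ i, ∑ j, coordDeriv j W y * chartFlux g e v i j y := by
    symm
    rw [← setIntegral_eq_integral_of_forall_compl_eq_zero (s := e.target)]
    · refine setIntegral_congr_fun e.open_target.measurableSet fun y hy ↦ ?_
      simp only [volDensity_mul_chartKappa, (hWe y hy).coordDeriv_eq]
    · intro y hy
      refine Finset.sum_eq_zero fun i _ ↦ Finset.sum_eq_zero fun j _ ↦ ?_
      rw [show coordDeriv j W y = 0 from by_contra fun h ↦ hy (hWt (hsuppdW j h)), zero_mul]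
  rw [hL, hR, integral_finsetSum _ fun i _ ↦ integrable_finsetSum _ fun j _ ↦ hi2 i j,
    integral_finsetSum _ fun i _ ↦ integrable_finsetSum _ fun j _ ↦ hi1 i j,
    ← Finset.sum_neg_distrib]
  refine Finset.sum_congr rfl fun i _ ↦ ?_
  rw [integral_finsetSum _ fun j _ ↦ hi2 i j, integral_finsetSum _ fun j _ ↦ hi1 i j,
    ← Finset.sum_neg_distrib]
  exact Finset.sum_congr rfl fun j _ ↦ hparts i j

/-- The conformality operator `κ(u, v)` as a function on the manifold. -/
def kappa (g : SmoothMetric m M) (u v : M → ℂ) (x : M) : ℂ :=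
  chartKappa g (chartAt (EuclideanSpace ℝ (Fin m)) x) u v
    (chartAt (EuclideanSpace ℝ (Fin m)) x x)

lemma kappa_eq_chartKappa (g : SmoothMetric m M)
    {e : OpenPartialHomeomorph M (EuclideanSpace ℝ (Fin m))}
    (he : e ∈ atlas (EuclideanSpace ℝ (Fin m)) M) {u v : M → ℂ}
    (hu : ContMDiff (𝓡 m) 𝓘(ℝ, ℂ) ∞ u) (hv : ContMDiff (𝓡 m) 𝓘(ℝ, ℂ) ∞ v)
    {x : M} (hx : x ∈ e.source) : kappa g u v x = chartKappa g e u v (e x) := by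
  have hxs := mem_chart_source (EuclideanSpace ℝ (Fin m)) x
  have h := chartKappa_transition g (chart_mem_atlas _ x) he (mem_chart_target _ x)
    (by rwa [OpenPartialHomeomorph.left_inv _ hxs]) hu hv
  rwa [Function.comp_apply, OpenPartialHomeomorph.left_inv _ hxs] at h

lemma continuousOn_chartKappa (g : SmoothMetric m M)
    {e : OpenPartialHomeomorph M (EuclideanSpace ℝ (Fin m))}
    (he : e ∈ atlas (EuclideanSpace ℝ (Fin m)) M) {u v : M → ℂ}
    (hu : ContMDiff (𝓡 m) 𝓘(ℝ, ℂ) ∞ u) (hv : ContMDiff (𝓡 m) 𝓘(ℝ, ℂ) ∞ v) :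
    ContinuousOn (chartKappa g e u v) e.target := by
  unfold chartKappa
  refine continuousOn_finsetSum _ fun i _ ↦ continuousOn_finsetSum _ fun j _ ↦ ?_
  refine ((Complex.continuous_ofReal.comp_continuousOn
    (contDiffOn_inv_gramMatrix g he i j).continuousOn).mul ?_).mul ?_
  · exact ((contDiffOn_comp_symm he hu).coordDeriv e.open_target i).continuousOn
  · exact ((contDiffOn_comp_symm he hv).coordDeriv e.open_target j).continuousOn

lemma continuous_kappa (g : SmoothMetric m M) {u v : M → ℂ}
    (hu : ContMDiff (𝓡 m) 𝓘(ℝ, ℂ) ∞ u) (hv : ContMDiff (𝓡 m) 𝓘(ℝ, ℂ) ∞ v) :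
    Continuous (kappa g u v) := by
  refine continuous_iff_continuousAt.2 fun x ↦ ?_
  have he := chart_mem_atlas (EuclideanSpace ℝ (Fin m)) x
  have hx := mem_chart_source (EuclideanSpace ℝ (Fin m)) x
  refine ContinuousAt.congr (((continuousOn_chartKappa g he hu hv).continuousAt
    ((chartAt _ x).open_target.mem_nhds (mem_chart_target _ x))).comp
      ((chartAt _ x).continuousAt hx)) ?_
  filter_upwards [(chartAt _ x).open_source.mem_nhds hx] with z hz
  exact (kappa_eq_chartKappa g he hu hv hz).symm

lemma kappa_comm (g : SmoothMetric m M) (u v : M → ℂ) (x : M) :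
    kappa g u v x = kappa g v u x := by
  have hsymm := (gramMatrix_posDef g (chart_mem_atlas (EuclideanSpace ℝ (Fin m)) x)
    (mem_chart_target _ x)).inv.isHermitian
  rw [kappa, kappa, chartKappa, chartKappa, Finset.sum_comm]
  refine Finset.sum_congr rfl fun i _ ↦ Finset.sum_congr rfl fun j _ ↦ ?_
  rw [← hsymm.apply i j, star_trivial]
  ring

lemma kappa_sum_right {ι : Type*} (g : SmoothMetric m M) (s : Finset ι) {u : M → ℂ}
    {w : ι → M → ℂ} (hw : ∀ i ∈ s, ContMDiff (𝓡 m) 𝓘(ℝ, ℂ) ∞ (w i)) (x : M) :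
    kappa g u (fun x ↦ ∑ i ∈ s, w i x) x = ∑ i ∈ s, kappa g u (w i) x := by
  have he := chart_mem_atlas (EuclideanSpace ℝ (Fin m)) x
  have h : ∀ j, coordDeriv j ((fun x ↦ ∑ i ∈ s, w i x) ∘ (chartAt _ x).symm)
      (chartAt (EuclideanSpace ℝ (Fin m)) x x) = ∑ i ∈ s,
      coordDeriv j (w i ∘ (chartAt _ x).symm) (chartAt (EuclideanSpace ℝ (Fin m)) x x) := by
    intro j
    have hd : ∀ i ∈ s, DifferentiableAt ℝ (w i ∘ (chartAt (EuclideanSpace ℝ (Fin m)) x).symm)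
        (chartAt (EuclideanSpace ℝ (Fin m)) x x) := fun i hi ↦
      ((contDiffOn_comp_symm he (hw i hi)).contDiffAt
        ((chartAt _ x).open_target.mem_nhds (mem_chart_target _ x))).differentiableAt (by simp)
    have := fderiv_fun_sum hd
    simp only [coordDeriv]
    rw [← _root_.sum_apply, ← this]
    rfl
  simp only [kappa, chartKappa, h, Finset.mul_sum]
  symm
  calc _ = ∑ k, ∑ i ∈ s, ∑ l, _ := Finset.sum_comm
    _ = _ := Finset.sum_congr rfl fun _ _ ↦ Finset.sum_comm

/-- Green's first identity for an eigenfunction of the Laplacian. -/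
lemma integral_mul_eq_neg_integral_kappa [T2Space M] [CompactSpace M] [MeasurableSpace M]
    [BorelSpace M] (g : SmoothMetric m M) {u v : M → ℂ} {c : ℂ}
    (hu : ContMDiff (𝓡 m) 𝓘(ℝ, ℂ) ∞ u) (hv : ContMDiff (𝓡 m) 𝓘(ℝ, ℂ) ∞ v)
    (hΔ : ∀ e ∈ atlas (EuclideanSpace ℝ (Fin m)) M, ∀ y ∈ e.target,
      chartLaplacian g e v y = c * v (e.symm y)) :
    c * ∫ x, u x * v x ∂(riemannianVolume g) = -∫ x, kappa g v u x ∂(riemannianVolume g) := by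
  -- Because `Δ v` equals `c v` in every chart, chart independence of the Laplacian is not needed;
  -- that of `κ` suffices.
  have hloc : ∀ e ∈ atlas (EuclideanSpace ℝ (Fin m)) M, ∀ w : M → ℂ,
      ContMDiff (𝓡 m) 𝓘(ℝ, ℂ) ∞ w → tsupport w ⊆ e.source →
      c * ∫ x, w x * v x ∂(riemannianVolume g) =
        -∫ x, kappa g v w x ∂(riemannianVolume g) := by
    intro e he w hw hwe
    have hw0 : ∀ x ∉ e.source, w =ᶠ[nhds x] 0 := fun x hx ↦
      notMem_tsupport_iff_eventuallyEq.1 fun h ↦ hx (hwe h)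
    have hκ0 : ∀ x ∉ e.source, kappa g v w x = 0 := by
      intro x hx
      have : w ∘ (chartAt (EuclideanSpace ℝ (Fin m)) x).symm =ᶠ[nhds (chartAt _ x x)] 0 := by
        have ht := (chartAt (EuclideanSpace ℝ (Fin m)) x).continuousAt_symm (mem_chart_target _ x)
        rw [ContinuousAt, (chartAt _ x).left_inv (mem_chart_source _ x)] at ht
        exact ht.eventually (hw0 x hx)
      have hd : ∀ j, coordDeriv j (w ∘ (chartAt (EuclideanSpace ℝ (Fin m)) x).symm)
          (chartAt (EuclideanSpace ℝ (Fin m)) x x) = 0 := fun j ↦ by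
        rw [this.coordDeriv_eq]
        simp [coordDeriv]
      simp [kappa, chartKappa, hd]
    rw [integral_riemannianVolume_eq g he (h := fun x ↦ w x * v x) (hw.continuous.mul hv.continuous)
      (fun x hx ↦ by simp [(hw0 x hx).eq_of_nhds]),
      integral_riemannianVolume_eq g he (continuous_kappa g hv hw) hκ0, ← integral_const_mul]
    trans ∫ y in e.target, (volDensity g e y : ℂ) * (w (e.symm y) * chartLaplacian g e v y)
    · refine setIntegral_congr_fun e.open_target.measurableSet fun y hy ↦ ?_
      rw [hΔ e he y hy]
      ring
    · rw [integral_mul_chartLaplacian g he hv hw hwe]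
      congr 1
      refine setIntegral_congr_fun e.open_target.measurableSet fun y hy ↦ ?_
      rw [kappa_eq_chartKappa g he hv hw (e.map_target hy), e.right_inv hy]
  -- Only `u` is cut off: the identity is linear in `u`, whereas `v` must remain an eigenfunction.
  -- Compactness leaves finitely many nonzero pieces.
  obtain ⟨ρ, hρ⟩ := SmoothPartitionOfUnity.exists_isSubordinate_chartAt_source (𝓡 m) M
  have hfin : {i | (Function.support (ρ i)).Nonempty}.Finite :=
    ρ.locallyFinite.finite_nonempty_of_compact
  set w : M → M → ℂ := fun i x ↦ ρ i x • u x
  have hw : ∀ i, ContMDiff (𝓡 m) 𝓘(ℝ, ℂ) ∞ (w i) := fun i ↦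
    (ρ i).contMDiff.smul hu
  have hsupp : ∀ i, tsupport (w i) ⊆ (chartAt (EuclideanSpace ℝ (Fin m)) i).source := fun i ↦
    
    (closure_mono (Function.support_subset_iff'.2 fun x hx ↦ by
      simp [w, Function.notMem_support.1 hx])).trans (hρ i)
  have hsum : u = fun x ↦ ∑ i ∈ hfin.toFinset, w i x := by
    ext x
    have h1 := ρ.sum_eq_one (Set.mem_univ x)
    rw [finsum_eq_sum_of_support_subset (s := hfin.toFinset)] at h1
    · rw [← Finset.sum_smul, h1, one_smul]
    · exact fun i hi ↦ hfin.mem_toFinset.2 ⟨x, hi⟩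
  have hint : ∀ h : M → ℂ, Continuous h → Integrable h (riemannianVolume g) := fun h hc ↦
    hc.integrable_of_hasCompactSupport (HasCompactSupport.of_compactSpace h)
  calc c * ∫ x, u x * v x ∂(riemannianVolume g)
      = ∑ i ∈ hfin.toFinset, c * ∫ x, w i x * v x ∂(riemannianVolume g) := by
        have h : ∀ x, u x * v x = ∑ i ∈ hfin.toFinset, w i x * v x := fun x ↦ by
          rw [← Finset.sum_mul, ← congrFun hsum x]
        simp only [h]
        rw [integral_finsetSum _ (f := fun i x ↦ w i x * v x)
          fun i _ ↦ hint _ ((hw i).continuous.mul hv.continuous),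
          Finset.mul_sum]
    _ = ∑ i ∈ hfin.toFinset, -∫ x, kappa g v (w i) x ∂(riemannianVolume g) :=
        Finset.sum_congr rfl fun i _ ↦ hloc _ (chart_mem_atlas _ i) _ (hw i) (hsupp i)
    _ = -∫ x, kappa g v u x ∂(riemannianVolume g) := by
        rw [Finset.sum_neg_distrib, ← integral_finsetSum _
          fun i _ ↦ hint _ (continuous_kappa g hv (hw i))]
        congr 2
        ext x
        rw [← kappa_sum_right g _ fun i _ ↦ hw i, ← hsum]

end Green

/-! ### Powers and conjugates of eigenfunctions; positivity of `κ(u, conj u)` -/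

section Powers

open scoped ComplexConjugate

variable {m : ℕ} {M : Type*} [TopologicalSpace M]
  [ChartedSpace (EuclideanSpace ℝ (Fin m)) M]

lemma ContMDiff.complex_conj {u : M → ℂ} (hu : ContMDiff (𝓡 m) 𝓘(ℝ, ℂ) ∞ u) :
    ContMDiff (𝓡 m) 𝓘(ℝ, ℂ) ∞ (fun x ↦ conj (u x)) :=
  Complex.conjCLE.contDiff.contMDiff.comp hu

lemma ContMDiff.complex_pow {u : M → ℂ} (hu : ContMDiff (𝓡 m) 𝓘(ℝ, ℂ) ∞ u) (n : ℕ) :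
    ContMDiff (𝓡 m) 𝓘(ℝ, ℂ) ∞ (fun x ↦ u x ^ n) :=
  (contDiff_id.pow n : ContDiff ℝ ∞ fun z : ℂ ↦ z ^ n).contMDiff.comp hu

variable [IsManifold (𝓡 m) ∞ M]

lemma coordDeriv_mul {h k : EuclideanSpace ℝ (Fin m) → ℂ} {y : EuclideanSpace ℝ (Fin m)}
    (hh : DifferentiableAt ℝ h y) (hk : DifferentiableAt ℝ k y) (i : Fin m) :
    coordDeriv i (fun z ↦ h z * k z) y = h y * coordDeriv i k y + k y * coordDeriv i h y := by
  simp [coordDeriv, fderiv_fun_mul hh hk]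

lemma coordDeriv_const_mul_pow {h : EuclideanSpace ℝ (Fin m) → ℂ} {y : EuclideanSpace ℝ (Fin m)}
    (hh : DifferentiableAt ℝ h y) (c : ℂ) (n : ℕ) (i : Fin m) :
    coordDeriv i (fun z ↦ c * h z ^ n) y = c * (n * h y ^ (n - 1)) * coordDeriv i h y := by
  have := ((hh.hasFDerivAt.pow n).const_mul c).fderiv
  simp only [coordDeriv] at this ⊢
  rw [this]
  simp
  ring

/-- The eigenvalue of the Laplacian on the `n`-th power of a `(lam, mu)`-eigenfunction. -/
def powEigenvalue (lam mu : ℂ) (n : ℕ) : ℂ := n * lam + n * (n - 1) * mu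

lemma IsEigenfunction.chartLaplacian_pow {g : SmoothMetric m M} {lam mu : ℂ} {f : M → ℂ}
    (hf : IsEigenfunction g lam mu f) (n : ℕ)
    {e : OpenPartialHomeomorph M (EuclideanSpace ℝ (Fin m))}
    (he : e ∈ atlas (EuclideanSpace ℝ (Fin m)) M) {y : EuclideanSpace ℝ (Fin m)}
    (hy : y ∈ e.target) :
    chartLaplacian g e (fun x ↦ f x ^ n) y = powEigenvalue lam mu n * f (e.symm y) ^ n := by
  have hvol : (volDensity g e y : ℂ) ≠ 0 := Complex.ofReal_ne_zero.2 (volDensity_pos g he hy).ne'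
  have hd : ∀ z ∈ e.target, DifferentiableAt ℝ (f ∘ e.symm) z := fun z hz ↦
    ((contDiffOn_comp_symm he hf.smooth).contDiffAt
      (e.open_target.mem_nhds hz)).differentiableAt (by simp)
  -- The flux of `f^n` is `n f^(n-1)` times that of `f`. Its divergence yields `n f^(n-1) Δf +
  -- n(n-1) f^(n-2) κ(f, f)`.
  have hflux : ∀ i j, chartFlux g e (fun x ↦ f x ^ n) i j =ᶠ[nhds y]
      fun z ↦ (n * (f ∘ e.symm) z ^ (n - 1)) * chartFlux g e f i j z := fun i j ↦ by
    filter_upwards [e.open_target.mem_nhds hy] with z hz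
    have := coordDeriv_const_mul_pow (hd z hz) 1 n i
    simp only [one_mul] at this
    rw [chartFlux, show (fun x ↦ f x ^ n) ∘ e.symm = fun z ↦ (f ∘ e.symm) z ^ n from rfl, this,
      chartFlux]
    ring
  have hterm : ∀ i j, coordDeriv j (chartFlux g e (fun x ↦ f x ^ n) i j) y =
      (n * f (e.symm y) ^ (n - 1)) * coordDeriv j (chartFlux g e f i j) y +
      (n * ((n - 1 : ℕ) * f (e.symm y) ^ (n - 1 - 1))) *
        (coordDeriv j (f ∘ e.symm) y * chartFlux g e f i j y) := fun i j ↦ by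
    have hdf : DifferentiableAt ℝ (chartFlux g e f i j) y :=
      ((contDiffOn_chartFlux g he hf.smooth i j).contDiffAt
        (e.open_target.mem_nhds hy)).differentiableAt (by simp)
    rw [(hflux i j).coordDeriv_eq, coordDeriv_mul (((hd y hy).fun_pow _).const_mul _) hdf,
      coordDeriv_const_mul_pow (hd y hy), Function.comp_apply]
    ring
  apply mul_left_cancel₀ hvol
  rw [volDensity_mul_chartLaplacian g he _ hy]
  simp only [hterm, Finset.sum_add_distrib, ← Finset.mul_sum]
  rw [← volDensity_mul_chartLaplacian g he _ hy, ← volDensity_mul_chartKappa,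
    hf.laplacian_eq e he y hy, hf.kappa_eq e he y hy, powEigenvalue]
  -- The exponents `n - 1` and `n - 1 - 1` are truncated; they combine to `f^n` directly only for `n
  -- ≥ 2`, while for smaller `n` the coefficients of the ill-formed terms vanish.
  rcases n with _ | _ | n
  · simp
  · simp
  · simp only [Nat.add_sub_cancel]
    push_cast
    ring

lemma coordDeriv_conj (h : EuclideanSpace ℝ (Fin m) → ℂ) (y : EuclideanSpace ℝ (Fin m))
    (i : Fin m) : coordDeriv i (fun z ↦ conj (h z)) y = conj (coordDeriv i h y) := by
  have := Complex.conjCLE.comp_fderiv (f := h) (x := y)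
  exact congrArg (fun L : EuclideanSpace ℝ (Fin m) →L[ℝ] ℂ ↦ L (EuclideanSpace.single i 1)) this

lemma chartLaplacian_conj (g : SmoothMetric m M)
    (e : OpenPartialHomeomorph M (EuclideanSpace ℝ (Fin m))) (u : M → ℂ)
    (y : EuclideanSpace ℝ (Fin m)) :
    chartLaplacian g e (fun x ↦ conj (u x)) y = conj (chartLaplacian g e u y) := by
  have h : ∀ i z, coordDeriv i ((fun x ↦ conj (u x)) ∘ e.symm) z =
    conj (coordDeriv i (u ∘ e.symm) z) := fun i z ↦ coordDeriv_conj (u ∘ e.symm) z i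
  simp only [chartLaplacian, map_sum, map_mul, Complex.conj_ofReal, ← coordDeriv_conj, h]

/-- The cross terms between real and imaginary parts cancel by symmetry of `H`. -/
lemma Matrix.PosDef.sum_mul_conj {ι : Type*} [Fintype ι] [DecidableEq ι] {H : Matrix ι ι ℝ}
    (hH : H.PosDef) (a : ι → ℂ) :
    (∑ i, ∑ j, (H i j : ℂ) * a i * conj (a j)).im = 0 ∧
    (∑ i, ∑ j, (H i j : ℂ) * a i * conj (a j)).re =
      (fun i ↦ (a i).re) ⬝ᵥ H.mulVec (fun i ↦ (a i).re) +
      (fun i ↦ (a i).im) ⬝ᵥ H.mulVec (fun i ↦ (a i).im) := by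
  constructor
  · simp only [Complex.im_sum, Complex.mul_im, Complex.mul_re, Complex.ofReal_re,
      Complex.ofReal_im, Complex.conj_re, Complex.conj_im, zero_mul, sub_zero, add_zero]
    simp only [Finset.sum_add_distrib]
    rw [add_comm, ← sub_neg_eq_add, sub_eq_zero, Finset.sum_comm, ← Finset.sum_neg_distrib]
    refine Finset.sum_congr rfl fun i _ ↦ ?_
    rw [← Finset.sum_neg_distrib]
    refine Finset.sum_congr rfl fun j _ ↦ ?_
    rw [← hH.isHermitian.apply i j, star_trivial]
    ring
  · simp only [Complex.re_sum, Complex.mul_im, Complex.mul_re, Complex.ofReal_re,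
      Complex.ofReal_im, Complex.conj_re, Complex.conj_im, zero_mul, sub_zero, add_zero,
      dotProduct, Matrix.mulVec, Finset.mul_sum, ← Finset.sum_add_distrib]
    exact Finset.sum_congr rfl fun i _ ↦ Finset.sum_congr rfl fun j _ ↦ by ring

lemma chartKappa_conj_self (g : SmoothMetric m M)
    {e : OpenPartialHomeomorph M (EuclideanSpace ℝ (Fin m))}
    (he : e ∈ atlas (EuclideanSpace ℝ (Fin m)) M) (u : M → ℂ) {y : EuclideanSpace ℝ (Fin m)}
    (hy : y ∈ e.target) :
    (chartKappa g e u (fun x ↦ conj (u x)) y).im = 0 ∧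
    0 ≤ (chartKappa g e u (fun x ↦ conj (u x)) y).re ∧
    ((chartKappa g e u (fun x ↦ conj (u x)) y).re = 0 →
      ∀ i, coordDeriv i (u ∘ e.symm) y = 0) := by
  have hH := (gramMatrix_posDef g he hy).inv
  have h : ∀ i, coordDeriv i ((fun x ↦ conj (u x)) ∘ e.symm) y =
    conj (coordDeriv i (u ∘ e.symm) y) := fun i ↦ coordDeriv_conj (u ∘ e.symm) y i
  have hsum := hH.sum_mul_conj fun i ↦ coordDeriv i (u ∘ e.symm) y
  have hnn : ∀ p : Fin m → ℝ, 0 ≤ p ⬝ᵥ (gramMatrix g e y)⁻¹.mulVec p := fun p ↦ by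
    simpa using hH.posSemidef.dotProduct_mulVec_nonneg p
  have hdef : ∀ p : Fin m → ℝ, p ⬝ᵥ (gramMatrix g e y)⁻¹.mulVec p = 0 → p = 0 := fun p hp ↦ by
    by_contra hne
    have := hH.dotProduct_mulVec_pos hne
    rw [star_trivial, hp] at this
    exact lt_irrefl _ this
  simp only [chartKappa, h]
  refine ⟨hsum.1, ?_, fun h0 i ↦ ?_⟩
  · rw [hsum.2]
    exact add_nonneg (hnn _) (hnn _)
  · rw [hsum.2] at h0
    have h1 := (add_eq_zero_iff_of_nonneg (hnn _) (hnn _)).1 h0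
    exact Complex.ext (congrFun (hdef _ h1.1) i) (congrFun (hdef _ h1.2) i)

/-- A smooth function with vanishing gradient is locally constant. -/
lemma isLocallyConstant_of_kappa_eq_zero (g : SmoothMetric m M) {u : M → ℂ}
    (hu : ContMDiff (𝓡 m) 𝓘(ℝ, ℂ) ∞ u)
    (h0 : ∀ x, (kappa g u (fun x ↦ conj (u x)) x).re = 0) : IsLocallyConstant u := by
  refine (IsLocallyConstant.iff_eventually_eq u).2 fun x ↦ ?_
  set e := chartAt (EuclideanSpace ℝ (Fin m)) x
  have he : e ∈ atlas (EuclideanSpace ℝ (Fin m)) M := chart_mem_atlas _ x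
  have hx : x ∈ e.source := mem_chart_source _ x
  have hfd : ∀ y ∈ e.target, fderiv ℝ (u ∘ e.symm) y = 0 := by
    intro y hy
    have h1 := h0 (e.symm y)
    rw [kappa_eq_chartKappa g he hu hu.complex_conj (e.map_target hy), e.right_inv hy] at h1
    have h2 := (chartKappa_conj_self g he u hy).2.2 h1
    refine ContinuousLinearMap.coe_injective
      ((EuclideanSpace.basisFun (Fin m) ℝ).toBasis.ext fun i ↦ ?_)
    simpa [coordDeriv] using h2 i
  obtain ⟨r, hr, hball⟩ := Metric.isOpen_iff.1 e.open_target (e x) (e.map_source hx)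
  have hmem : e.source ∩ e ⁻¹' Metric.ball (e x) r ∈ nhds x :=
    (e.isOpen_inter_preimage Metric.isOpen_ball).mem_nhds ⟨hx, Metric.mem_ball_self hr⟩
  filter_upwards [hmem] with z hz
  have := Metric.isOpen_ball.is_const_of_fderiv_eq_zero (𝕜 := ℝ)
    (convex_ball (e x) r).isPreconnected
    (((contDiffOn_comp_symm he hu).differentiableOn (by simp)).mono hball)
    (fun y hy ↦ hfd y (hball hy)) hz.2 (Metric.mem_ball_self hr)
  simpa [e.left_inv hz.1, e.left_inv hx] using this

end Powers

/-! ### Signs of eigenvalues and orthogonality of powers -/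

section Orthogonality

open scoped ComplexConjugate

variable {m : ℕ} {M : Type*} [TopologicalSpace M] [CompactSpace M]
  [ChartedSpace (EuclideanSpace ℝ (Fin m)) M] [IsManifold (𝓡 m) ∞ M]
  [MeasurableSpace M] [BorelSpace M]

lemma integrable_riemannianVolume {F : Type*} [NormedAddCommGroup F] (g : SmoothMetric m M)
    {h : M → F} (hc : Continuous h) : Integrable h (riemannianVolume g) :=
  hc.integrable_of_hasCompactSupport (HasCompactSupport.of_compactSpace h)

variable [T2Space M]

/-- A Laplace eigenvalue on a compact manifold is real and nonpositive, and it is zero only for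
locally constant functions. -/
lemma laplacian_eigenvalue_nonpos (g : SmoothMetric m M) {v : M → ℂ} {c : ℂ}
    (hv : ContMDiff (𝓡 m) 𝓘(ℝ, ℂ) ∞ v) (hv0 : v ≠ 0)
    (hΔ : ∀ e ∈ atlas (EuclideanSpace ℝ (Fin m)) M, ∀ y ∈ e.target,
      chartLaplacian g e v y = c * v (e.symm y)) :
    c.im = 0 ∧ c.re ≤ 0 ∧ (c = 0 → IsLocallyConstant v) := by
  have hκ : ∀ x, (kappa g v (fun x ↦ conj (v x)) x).im = 0 ∧
      0 ≤ (kappa g v (fun x ↦ conj (v x)) x).re := fun x ↦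
    have h := chartKappa_conj_self g (chart_mem_atlas (EuclideanSpace ℝ (Fin m)) x) v
      (mem_chart_target _ x)
    ⟨h.1, h.2.1⟩
  have hκc : Continuous fun x ↦ (kappa g v (fun x ↦ conj (v x)) x).re :=
    Complex.continuous_re.comp (continuous_kappa g hv hv.complex_conj)
  have hgreen := integral_mul_eq_neg_integral_kappa g hv.complex_conj hv hΔ
  have h1 : ∫ x, conj (v x) * v x ∂(riemannianVolume g) =
      ((∫ x, ‖v x‖ ^ 2 ∂(riemannianVolume g) : ℝ) : ℂ) := by
    rw [← integral_complex_ofReal]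
    simp only [Complex.conj_mul', Complex.ofReal_pow]
  have h2 : ∫ x, kappa g v (fun x ↦ conj (v x)) x ∂(riemannianVolume g) =
      ((∫ x, (kappa g v (fun x ↦ conj (v x)) x).re ∂(riemannianVolume g) : ℝ) : ℂ) := by
    rw [← integral_complex_ofReal]
    congr 1
    ext x
    exact Complex.ext rfl (by simp [(hκ x).1])
  rw [h1, h2] at hgreen
  have hpos : 0 < ∫ x, ‖v x‖ ^ 2 ∂(riemannianVolume g) := by
    obtain ⟨x, hx⟩ := Function.ne_iff.1 hv0
    exact (hv.continuous.norm.pow 2).integral_pos_of_hasCompactSupport_nonneg_nonzero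
      (HasCompactSupport.of_compactSpace _) (fun x ↦ by positivity) (x := x) (by simpa using hx)
  have hnn : 0 ≤ ∫ x, (kappa g v (fun x ↦ conj (v x)) x).re ∂(riemannianVolume g) :=
    integral_nonneg fun x ↦ (hκ x).2
  have hre := congrArg Complex.re hgreen
  have him := congrArg Complex.im hgreen
  simp only [Complex.re_mul_ofReal, Complex.im_mul_ofReal, Complex.neg_re, Complex.neg_im,
    Complex.ofReal_re, Complex.ofReal_im, neg_zero] at hre him
  -- Green's identity with `u = conj v` reads `c ∫ ‖v‖² = -∫ κ(v, conj v)`, where both integrals are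
  -- real and nonnegative and the first is positive.
  refine ⟨(mul_eq_zero.1 him).resolve_right hpos.ne', by nlinarith, fun hc ↦ ?_⟩
  refine isLocallyConstant_of_kappa_eq_zero g hv ?_
  rw [hc, Complex.zero_re, zero_mul, eq_comm, neg_eq_zero] at hre
  have h3 := (integral_eq_zero_iff_of_nonneg (fun x ↦ (hκ x).2)
    (integrable_riemannianVolume g hκc)).1 hre
  exact congrFun ((hκc.ae_eq_iff_eq _ continuous_zero).1 h3)

/-- Powers of an eigenfunction are orthogonal. -/
lemma IsEigenfunction.integral_pow_mul_conj_pow {g : SmoothMetric m M} {lam mu : ℂ} {f : M → ℂ}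
    (hf : IsEigenfunction g lam mu f) (hconst : ¬ IsLocallyConstant f) {j k : ℕ} (hjk : j ≠ k) :
    ∫ x, f x ^ j * conj (f x) ^ k ∂(riemannianVolume g) = 0 := by
  have hf0 : f ≠ 0 := fun h ↦ hconst (h ▸ IsLocallyConstant.const 0)
  have hpow0 : ∀ n, (fun x ↦ f x ^ n) ≠ 0 := fun n h ↦ hf0 (funext fun x ↦
    eq_zero_of_pow_eq_zero (congrFun h x))
  have hsm : ∀ n, ContMDiff (𝓡 m) 𝓘(ℝ, ℂ) ∞ (fun x ↦ f x ^ n) := fun n ↦ hf.smooth.complex_pow n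
  have heig : ∀ n, ∀ e ∈ atlas (EuclideanSpace ℝ (Fin m)) M, ∀ y ∈ e.target,
      chartLaplacian g e (fun x ↦ f x ^ n) y =
        powEigenvalue lam mu n * (fun x ↦ f x ^ n) (e.symm y) :=
    fun n e he y hy ↦ hf.chartLaplacian_pow n he hy
  have hΛ := fun n ↦ laplacian_eigenvalue_nonpos g (hsm n) (hpow0 n) (heig n)
  obtain ⟨hlam_im, hlam_re, hlam0⟩ := laplacian_eigenvalue_nonpos g hf.smooth hf0 hf.laplacian_eq
  have hlam_ne : lam.re ≠ 0 := fun h ↦ hconst (hlam0 (Complex.ext h hlam_im))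
  have hlam_neg : lam.re < 0 := lt_of_le_of_ne hlam_re hlam_ne
  have hΛre : ∀ n, (powEigenvalue lam mu n).re = n * lam.re + n * (n - 1) * mu.re := by
    intro n
    simp [powEigenvalue]
  -- `Λ_{n+1} = (n+1)(λ + nμ)`, whose real part would be positive for large `n` if `Re μ > 0`.
  have hmu : mu.re ≤ 0 := by
    by_contra! hmu
    obtain ⟨n, hn⟩ := exists_nat_gt (-lam.re / mu.re)
    have h1 := (hΛ (n + 1)).2.1
    rw [hΛre] at h1
    rw [div_lt_iff₀ hmu] at hn
    push_cast at h1
    nlinarith [Nat.cast_nonneg (α := ℝ) n]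
  have hne : powEigenvalue lam mu j ≠ powEigenvalue lam mu k := by
    intro h
    have h1 := congrArg Complex.re h
    rw [hΛre, hΛre] at h1
    have hjk' : (j : ℝ) - k ≠ 0 := sub_ne_zero.2 (Nat.cast_injective.ne hjk)
    -- This is `Re (Λ_j - Λ_k)` divided by `j - k`. It is impossible, since `j ≠ k` gives `j + k ≥
    -- 1` and so the left side is negative.
    have h2 : lam.re + (j + k - 1) * mu.re = 0 := by
      apply mul_left_cancel₀ hjk'
      linear_combination h1
    have h3 : (1 : ℝ) ≤ j + k := by
      exact_mod_cast (show 1 ≤ j + k by lia)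
    nlinarith
  -- Conjugation keeps the eigenvalue `Λ_k` because it is real.
  have hk : ∀ e ∈ atlas (EuclideanSpace ℝ (Fin m)) M, ∀ y ∈ e.target,
      chartLaplacian g e (fun x ↦ conj (f x ^ k)) y =
        powEigenvalue lam mu k * (fun x ↦ conj (f x ^ k)) (e.symm y) := fun e he y hy ↦ by
    rw [chartLaplacian_conj, hf.chartLaplacian_pow k he hy, map_mul,
      Complex.conj_eq_iff_im.2 (hΛ k).1]
  -- Green's identity in both orders, together with the symmetry of `κ`, gives `Λ_j ∫ = Λ_k ∫` for
  -- the same integral.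
  have h1 := integral_mul_eq_neg_integral_kappa g (hsm k).complex_conj (hsm j) (heig j)
  have h2 := integral_mul_eq_neg_integral_kappa g (hsm j) (hsm k).complex_conj hk
  have h3 : ∀ x, kappa g (fun x ↦ conj (f x ^ k)) (fun x ↦ f x ^ j) x =
    kappa g (fun x ↦ f x ^ j) (fun x ↦ conj (f x ^ k)) x := kappa_comm g _ _
  simp only [h3, ← h1, mul_comm (conj (f _ ^ k))] at h2
  simp only [← map_pow]
  by_contra h0
  exact hne (mul_right_cancel₀ h0 h2).symm

end Orthogonality

/-! ### Moments of a rotation invariant distribution -/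

section Moments

open MvPolynomial
open scoped ComplexConjugate

/-- The derivation `z ∂/∂z - w ∂/∂w` on polynomials in `z` and `w`; for `w = conj z` it is the
infinitesimal rotation, up to the factor `i`. -/
def rotationDerivation :
    Derivation ℂ (MvPolynomial (Fin 2) ℂ) (MvPolynomial (Fin 2) ℂ) :=
  mkDerivation ℂ ![X 0, -X 1]

lemma rotationDerivation_X_zero : rotationDerivation (X 0) = X 0 := by
  simp [rotationDerivation]

lemma rotationDerivation_X_one : rotationDerivation (X 1) = -X 1 := by
  simp [rotationDerivation]

/-- The weight `j - k` of `z^j w^k` vanishes exactly on the monomials whose integral is not known to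
be zero. -/
lemma rotationDerivation_monomial (s : Fin 2 →₀ ℕ) (c : ℂ) :
    rotationDerivation (monomial s c) = ((s 0 : ℂ) - s 1) • monomial s c := by
  have hpow : ∀ (i : Fin 2) (ε : ℂ), rotationDerivation (X i) = ε • X i → ∀ n : ℕ,
      rotationDerivation (X i ^ n) = (n * ε) • X i ^ n := by
    intro i ε h n
    induction n with
    | zero => simp
    | succ n ih =>
      rw [pow_succ, Derivation.leibniz, ih, h]
      simp only [smul_eq_mul, smul_eq_C_mul, map_mul, map_natCast, Nat.cast_add, Nat.cast_one,
        map_add, map_one]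
      ring
  rw [monomial_eq, Finsupp.prod_fintype _ _ (by simp), Fin.prod_univ_two, C_mul', Derivation.map_smul,
    Derivation.leibniz, hpow 0 1 (by simp [rotationDerivation_X_zero]),
    hpow 1 (-1) (by simp [rotationDerivation_X_one])]
  simp only [smul_eq_mul, smul_eq_C_mul, map_mul, map_natCast, map_sub, map_one, map_neg]
  ring

lemma continuous_eval_conj {X : Type*} [TopologicalSpace X] {f : X → ℂ} (hf : Continuous f)
    (P : MvPolynomial (Fin 2) ℂ) :
    Continuous fun x ↦ eval ![f x, conj (f x)] P := by
  refine (MvPolynomial.continuous_eval P).comp (continuous_pi fun i ↦ ?_)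
  fin_cases i
  · exact hf
  · exact Complex.continuous_conj.comp hf

variable {X : Type*} [TopologicalSpace X] [CompactSpace X] [MeasurableSpace X]
  [OpensMeasurableSpace X] {μ : Measure X} [IsFiniteMeasureOnCompacts μ] {f : X → ℂ}

lemma integral_eval_rotationDerivation (hf : Continuous f)
    (horth : ∀ j k : ℕ, j ≠ k → ∫ x, f x ^ j * conj (f x) ^ k ∂μ = 0)
    (P : MvPolynomial (Fin 2) ℂ) :
    ∫ x, eval ![f x, conj (f x)] (rotationDerivation P) ∂μ = 0 := by
  induction P using MvPolynomial.induction_on' with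
  | monomial s c =>
    rw [rotationDerivation_monomial]
    simp only [smul_eval, eval_monomial, Finsupp.prod_fintype _ _ fun _ ↦ pow_zero _,
      Fin.prod_univ_two, integral_const_mul, Matrix.cons_val_zero, Matrix.cons_val_one]
    by_cases h : s 0 = s 1
    · simp [h]
    · simp [horth _ _ h]
  | add P Q hP hQ =>
    have hint : ∀ R : MvPolynomial (Fin 2) ℂ,
        Integrable (fun x ↦ eval ![f x, conj (f x)] R) μ := fun R ↦
      (continuous_eval_conj hf R).integrable_of_hasCompactSupport
        (HasCompactSupport.of_compactSpace _)
    simp only [map_add]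
    rw [integral_add (hint _) (hint _), hP, hQ, add_zero]

/-- If `∫ f ^ j * conj f ^ k = 0` for `j ≠ k`, then integrals of infinitesimal rotations of
monomials in the real and imaginary part of `f` vanish. -/
lemma integral_rotation_re_im (hf : Continuous f)
    (horth : ∀ j k : ℕ, j ≠ k → ∫ x, f x ^ j * conj (f x) ^ k ∂μ = 0) (a b : ℕ) :
    a * ∫ x, (f x).re ^ (a - 1) * (f x).im ^ (b + 1) ∂μ =
      b * ∫ x, (f x).re ^ (a + 1) * (f x).im ^ (b - 1) ∂μ := by
  -- `p` and `q` take the values `Re f` and `Im f` at `(f, conj f)`, and the derivation rotates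
  -- them: `p ↦ i q`, `q ↦ -i p`.
  set p : MvPolynomial (Fin 2) ℂ := C (1 / 2) * (MvPolynomial.X 0 + MvPolynomial.X 1) with hp
  set q : MvPolynomial (Fin 2) ℂ := C (-Complex.I / 2) * (MvPolynomial.X 0 - MvPolynomial.X 1)
    with hq
  have hDp : rotationDerivation p = C Complex.I * q := by
    rw [hp, hq, C_mul', Derivation.map_smul, map_add, rotationDerivation_X_zero, rotationDerivation_X_one,
      ← mul_assoc, ← C_mul, smul_eq_C_mul, ← sub_eq_add_neg]
    congr 2
    linear_combination (1 / 2 : ℂ) * Complex.I_mul_I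
  have hDq : rotationDerivation q = -C Complex.I * p := by
    rw [hp, hq, C_mul', Derivation.map_smul, map_sub, rotationDerivation_X_zero, rotationDerivation_X_one,
      ← mul_assoc, ← C_neg, ← C_mul, smul_eq_C_mul, sub_neg_eq_add]
    congr 2
    ring
  have hep : ∀ x, eval ![f x, conj (f x)] p = ((f x).re : ℂ) := fun x ↦ by
    simp [hp, Complex.add_conj]
  have heq : ∀ x, eval ![f x, conj (f x)] q = ((f x).im : ℂ) := fun x ↦ by
    simp only [hq, map_mul, map_sub, eval_C, eval_X, Matrix.cons_val_zero, Matrix.cons_val_one,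
      Complex.sub_conj]
    push_cast
    linear_combination (-(f x).im : ℂ) * Complex.I_mul_I
  have h := integral_eval_rotationDerivation hf horth (p ^ a * q ^ b)
  have hD : ∀ x, eval ![f x, conj (f x)] (rotationDerivation (p ^ a * q ^ b)) =
      Complex.I * ((a * ((f x).re ^ (a - 1) * (f x).im ^ (b + 1)) -
        b * ((f x).re ^ (a + 1) * (f x).im ^ (b - 1)) : ℝ) : ℂ) := fun x ↦ by
    rw [Derivation.leibniz, Derivation.leibniz_pow, Derivation.leibniz_pow, hDp, hDq]
    simp only [smul_eq_mul, map_add, map_mul, map_pow, hep, heq, map_neg, eval_C,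
      nsmul_eq_mul, map_natCast]
    push_cast
    ring
  have hint : ∀ c d : ℕ, Integrable (fun x ↦ (f x).re ^ c * (f x).im ^ d) μ := fun c d ↦
    (((Complex.continuous_re.comp hf).pow c).mul
      ((Complex.continuous_im.comp hf).pow d)).integrable_of_hasCompactSupport
        (HasCompactSupport.of_compactSpace _)
  simp only [hD] at h
  rw [integral_const_mul, integral_complex_ofReal, mul_eq_zero, Complex.ofReal_eq_zero,
    integral_sub ((hint _ _).const_mul _) ((hint _ _).const_mul _), integral_const_mul,
    integral_const_mul] at h
  exact sub_eq_zero.1 (h.resolve_left Complex.I_ne_zero)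

/-- Moments satisfying the relations of a rotationally invariant distribution vanish unless both
exponents are even. -/
lemma moment_eq_zero_of_not_even {I : ℕ → ℕ → ℝ}
    (hI : ∀ a b : ℕ, a * I (a - 1) (b + 1) = b * I (a + 1) (b - 1)) {a b : ℕ}
    (hab : ¬ (Even a ∧ Even b)) : I a b = 0 := by
  rw [not_and_or, Nat.not_even_iff_odd, Nat.not_even_iff_odd] at hab
  -- The relation shifts the exponents by two in opposite directions, so an odd exponent descends to
  -- `1`, where one side of the relation has coefficient `0`.
  rcases hab with ⟨c, rfl⟩ | ⟨c, rfl⟩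
  · induction c generalizing b with
    | zero =>
      have h := hI 0 (b + 1)
      simp only [Nat.cast_zero, zero_mul, zero_eq_mul, Nat.add_sub_cancel, zero_add] at h
      exact h.resolve_left (by positivity)
    | succ c ih =>
      have h := hI (2 * c + 2) (b + 1)
      rw [show 2 * c + 2 - 1 = 2 * c + 1 by lia, ih, mul_zero, zero_eq_mul] at h
      exact h.resolve_left (by positivity)
  · induction c generalizing a with
    | zero =>
      have h := hI (a + 1) 0
      simp only [Nat.cast_zero, zero_mul, mul_eq_zero, Nat.add_sub_cancel, zero_add] at h
      exact h.resolve_left (by positivity)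
    | succ c ih =>
      have h := hI (a + 1) (2 * c + 2)
      rw [show 2 * c + 2 - 1 = 2 * c + 1 by lia, ih, mul_zero, mul_eq_zero] at h
      exact h.resolve_left (by positivity)

/-- The even moments of a rotationally invariant distribution. -/
lemma moment_even_even {I : ℕ → ℕ → ℝ}
    (hI : ∀ a b : ℕ, a * I (a - 1) (b + 1) = b * I (a + 1) (b - 1)) (a b : ℕ) :
    I (2 * a) (2 * b) =
      ((a + b).choose a : ℝ) / ((2 * a + 2 * b).choose (2 * a) : ℝ) * I (2 * a + 2 * b) 0 := by
  suffices h : I (2 * a) (2 * b) * ((2 * a + 2 * b).choose (2 * a) : ℝ) =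
      ((a + b).choose a : ℝ) * I (2 * a + 2 * b) 0 by
    have hpos : ((2 * a + 2 * b).choose (2 * a) : ℝ) ≠ 0 :=
      Nat.cast_ne_zero.2 (Nat.choose_pos (by lia)).ne'
    rw [div_mul_eq_mul_div, eq_div_iff hpos, h]
  -- Each step trades `(2a, 2b + 2)` for `(2a + 2, 2b)`; `h2`, `h3`, `h4` are the matching ratios of
  -- consecutive binomial coefficients.
  induction b generalizing a with
  | zero => simp
  | succ b ih =>
    have h0 := hI (2 * a + 1) (2 * b + 1)
    have h1 := ih (a + 1)
    have h2 := Nat.choose_succ_right_eq (a + (b + 1)) a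
    have h3 := Nat.choose_succ_right_eq (2 * a + 2 * (b + 1)) (2 * a)
    have h4 := Nat.choose_succ_right_eq (2 * a + 2 * (b + 1)) (2 * a + 1)
    rw [show a + (b + 1) - a = b + 1 by lia] at h2
    rw [show 2 * a + 2 * (b + 1) - 2 * a = 2 * b + 2 by lia] at h3
    rw [show 2 * a + 2 * (b + 1) - (2 * a + 1) = 2 * b + 1 by lia] at h4
    rw [show 2 * (a + 1) + 2 * b = 2 * a + 2 * (b + 1) by ring,
      show a + 1 + b = a + (b + 1) by ring, show 2 * (a + 1) = 2 * a + 1 + 1 by ring] at h1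
    simp only [Nat.add_sub_cancel] at h0
    rw [show 2 * (b + 1) = 2 * b + 1 + 1 by ring] at *
    have h2' : ((a + (b + 1)).choose (a + 1) : ℝ) * (a + 1) =
      (a + (b + 1)).choose a * (b + 1) := by exact_mod_cast h2
    have h3' : ((2 * a + (2 * b + 1 + 1)).choose (2 * a + 1) : ℝ) * (2 * a + 1) =
      (2 * a + (2 * b + 1 + 1)).choose (2 * a) * (2 * b + 2) := by exact_mod_cast h3
    have h4' : ((2 * a + (2 * b + 1 + 1)).choose (2 * a + 1 + 1) : ℝ) * (2 * a + 1 + 1) =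
      (2 * a + (2 * b + 1 + 1)).choose (2 * a + 1) * (2 * b + 1) := by exact_mod_cast h4
    push_cast at h0
    have hne : ((2 * b + 2) * (2 * b + 1) : ℝ) ≠ 0 := by positivity
    apply mul_right_cancel₀ hne
    linear_combination (-(2 * b + 1) * I (2 * a) (2 * b + 1 + 1)) * h3' -
      (2 * a + 1) * I (2 * a) (2 * b + 1 + 1) * h4' +
      (2 * a + 2) * ((2 * a + (2 * b + 1 + 1)).choose (2 * a + 1 + 1) : ℝ) * h0 +
      (2 * b + 1) * (2 * a + 2) * h1 + 2 * (2 * b + 1) * I (2 * a + (2 * b + 1 + 1)) 0 * h2'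

end Moments

end

theorem mainTheorem3 {m : ℕ} {M : Type*} [TopologicalSpace M] [T2Space M] [CompactSpace M]
    [ChartedSpace (EuclideanSpace ℝ (Fin m)) M] [IsManifold (𝓡 m) ∞ M]
    [MeasurableSpace M] [BorelSpace M]
    (g : SmoothMetric m M) (lam mu : ℂ) (f : M → ℂ) (hf : IsEigenfunction g lam mu f)
    (hconst : IsLocallyConstant f → f = 0) :
    (∀ a b : ℕ, Integrable (fun x ↦ (f x).re ^ a * (f x).im ^ b) (riemannianVolume g)) ∧
    (∀ a b : ℕ, ¬ (Even a ∧ Even b) →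
      ∫ x, (f x).re ^ a * (f x).im ^ b ∂(riemannianVolume g) = 0) ∧
    (∀ a b : ℕ,
      ∫ x, (f x).re ^ (2 * a) * (f x).im ^ (2 * b) ∂(riemannianVolume g) =
        (((a + b).choose a : ℝ) / ((2 * a + 2 * b).choose (2 * a) : ℝ)) *
          ∫ x, (f x).re ^ (2 * a + 2 * b) ∂(riemannianVolume g)) := by
  have hc : Continuous f := hf.smooth.continuous
  have horth : ∀ j k : ℕ, j ≠ k →
      ∫ x, f x ^ j * starRingEnd ℂ (f x) ^ k ∂(riemannianVolume g) = 0 := by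
    intro j k hjk
    -- The zero function is allowed; there `j ≠ k` makes `j + k` positive, so the integrand
    -- vanishes.
    by_cases hloc : IsLocallyConstant f
    · have h0 : ∀ z : ℂ, z = 0 → z ^ j * starRingEnd ℂ z ^ k = 0 := by
        rintro z rfl
        rw [map_zero, ← pow_add, zero_pow (by lia)]
      simp [h0 _ (congrFun (hconst hloc) _)]
    · exact hf.integral_pow_mul_conj_pow hloc hjk
  have hI := integral_rotation_re_im hc horth
  refine ⟨fun a b ↦ integrable_riemannianVolume g (((Complex.continuous_re.comp hc).pow a).mul
    ((Complex.continuous_im.comp hc).pow b)), fun a b hab ↦ ?_, fun a b ↦ ?_⟩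
  · exact moment_eq_zero_of_not_even
      (I := fun a b ↦ ∫ x, (f x).re ^ a * (f x).im ^ b ∂(riemannianVolume g)) hI hab
  · have h := moment_even_even
      (I := fun a b ↦ ∫ x, (f x).re ^ a * (f x).im ^ b ∂(riemannianVolume g)) hI a b
    simpa only [pow_zero, mul_one] using h
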